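/- Let $(S,\mathfrak n)$ be a commutative noetherian local ring and let $\omega\in\mathfrak n$ be a non-zerodivisor. Let $\mathsf{Mon}(\omega,\mathcal P)$ be the category whose objects are the monomorphisms $f\colon P_1\to P_0$ between finitely generated projective $S$-modules with $\omega\operatorname{Coker} f=0$, and whose morphisms are commutative squares. Let $\mathsf{MF}(\omega,\mathcal P)$ be the category of matrix factorizations of $\omega$: its objects are pairs of $S$-homomorphisms $\rho_1\colon P_1\to P_0$, $\rho_0\colon P_0\to P_1$ between finitely generated projective $S$-modules such that $\rho_0\rho_1=\omega\cdot\mathrm{id}_{P_1}$ and $\rho_1\rho_0=\omega\cdot\mathrm{id}_{P_0}$, and its morphisms are pairs $(\psi_1,\psi_0)$ of $S$-homomorphisms commuting with both structure maps. In both categories take as conflations the short sequences which are short exact sequences of $S$-modules in each of the two degrees. With these conflations $\mathsf{Mon}(\omega,\mathcal P)$ and $\mathsf{MF}(\omega,\mathcal P)$ are Frobenius categories, that is, Quillen exact categories with enough projectives and enough injectives in which the projective and the injective objects coincide. The stable category $\underline{\mathcal C}$ of a Frobenius category $\mathcal C$ has the same objects as $\mathcal C$, and its morphisms are those of $\mathcal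 C$ modulo those that factor through a projective object. It carries its standard triangulated structure: the suspension $\Sigma X$ is given by a chosen conflation $X\to I(X)\to\Sigma X$ with $I(X)$ injective, and the distinguished triangles are those isomorphic in $\underline{\mathcal C}$ to a triangle $X\xrightarrow{u}Y\to C_u\to\Sigma X$, where $u$ is a morphism of $\mathcal C$, $C_u$ is the push-out of $u$ and $X\to I(X)$, and $C_u\to\Sigma X$ is induced by $0\colon Y\to\Sigma X$ and $I(X)\to\Sigma X$. Then there is a triangle equivalence $$F'\colon \underline{\mathsf{Mon}}(\omega,\mathcal P)\longrightarrow\underline{\mathsf{MF}}(\omega,\mathcal P),$$ that is, an additive functor which is an equivalence of categories, together with a natural isomorphism $F'\Sigma\cong\Sigma F'$ through which $F'$ sends distinguished triangles to distinguished triangles. -/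

import Mathlib

open CategoryTheory CategoryTheory.Limits

universe v u

/-! ## Exact categories and Frobenius categories -/

namespace QuillenExact

section Basic

variable {C : Type u} [Category.{v} C] [Preadditive C] (E : ObjectProperty (ShortComplex C))

/-- `i` is an admissible monic (inflation) for the class `E` of conflations. -/
def IsInflation {X Y : C} (i : X ⟶ Y) : Prop :=
  ∃ (Z : C) (p : Y ⟶ Z) (w : i ≫ p = 0), E (ShortComplex.mk i p w)

/-- `p` is an admissible epic (deflation) for the class `E` of conflations. -/
def IsDeflation {Y Z : C} (p : Y ⟶ Z) : Prop :=
  ∃ (X : C) (i : X ⟶ Y) (w : i ≫ p = 0), E (ShortComplex.mk i p w)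

/-- `(C, E)` is an exact category in the sense of Quillen (in Bühler's axiomatization):
`C` is additive, and `E` is an isomorphism-closed class of kernel-cokernel pairs satisfying
(E0), (E0ᵒᵖ), (E1), (E1ᵒᵖ), (E2), (E2ᵒᵖ). -/
class IsExactCategory : Prop where
  hasFiniteBiproducts : HasFiniteBiproducts C
  closedUnderIso : E.IsClosedUnderIsomorphisms
  isKernel : ∀ T : ShortComplex C, E T → Nonempty (IsLimit (KernelFork.ofι T.f T.zero))
  isCokernel : ∀ T : ShortComplex C, E T → Nonempty (IsColimit (CokernelCofork.ofπ T.g T.zero))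
  inflation_id : ∀ X : C, IsInflation E (𝟙 X)
  deflation_id : ∀ X : C, IsDeflation E (𝟙 X)
  inflation_comp : ∀ {X Y Z : C} (i : X ⟶ Y) (j : Y ⟶ Z),
    IsInflation E i → IsInflation E j → IsInflation E (i ≫ j)
  deflation_comp : ∀ {X Y Z : C} (p : X ⟶ Y) (q : Y ⟶ Z),
    IsDeflation E p → IsDeflation E q → IsDeflation E (p ≫ q)
  inflation_pushout : ∀ {X Y X' : C} (i : X ⟶ Y) (f : X ⟶ X'), IsInflation E i →
    ∃ (Y' : C) (f' : Y ⟶ Y') (i' : X' ⟶ Y'), IsPushout i f f' i' ∧ IsInflation E i'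
  deflation_pullback : ∀ {Y Z Z' : C} (p : Y ⟶ Z) (g : Z' ⟶ Z), IsDeflation E p →
    ∃ (Y' : C) (g' : Y' ⟶ Y) (p' : Y' ⟶ Z'), IsPullback g' p' p g ∧ IsDeflation E p'

/-- Projective objects relative to the exact structure. -/
def IsProj (P : C) : Prop :=
  ∀ ⦃Y Z : C⦄ (p : Y ⟶ Z), IsDeflation E p → ∀ f : P ⟶ Z, ∃ g : P ⟶ Y, g ≫ p = f

/-- Injective objects relative to the exact structure. -/
def IsInj (I : C) : Prop :=
  ∀ ⦃X Y : C⦄ (i : X ⟶ Y), IsInflation E i → ∀ f : X ⟶ I, ∃ g : Y ⟶ I, i ≫ g = f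

/-- A Frobenius category: an exact category with enough projectives and enough injectives,
in which the projective objects coincide with the injective ones. -/
class IsFrobenius : Prop extends IsExactCategory E where
  enoughProj : ∀ X : C, ∃ (P : C) (p : P ⟶ X), IsProj E P ∧ IsDeflation E p
  enoughInj : ∀ X : C, ∃ (I : C) (i : X ⟶ I), IsInj E I ∧ IsInflation E i
  proj_iff_inj : ∀ X : C, IsProj E X ↔ IsInj E X

/-! ## The stable category -/

/-- Two parallel morphisms are identified in the stable category if their difference factors
through a projective object. -/
def stableRel : HomRel C := fun X Y f g =>
  ∃ (P : C) (a : X ⟶ P) (b : P ⟶ Y), IsProj E P ∧ a ≫ b = f - g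

/-- The stable category: the quotient of `C` by the morphisms factoring through projectives. -/
abbrev StableCategory : Type u := CategoryTheory.Quotient (stableRel E)

/-- The projection onto the stable category. -/
abbrev toStable : C ⥤ StableCategory E := CategoryTheory.Quotient.functor (stableRel E)

variable {E}

lemma IsProj.of_isZero {X : C} (h : IsZero X) : IsProj E X := fun _ _ _ _ _ =>
  ⟨0, h.eq_of_src _ _⟩

lemma IsProj.biprod {P Q : C} [HasBinaryBiproduct P Q] (hP : IsProj E P) (hQ : IsProj E Q) :
    IsProj E (P ⊞ Q) := by
  intro Y Z p hp f
  obtain ⟨a, ha⟩ := hP p hp (biprod.inl ≫ f)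
  obtain ⟨b, hb⟩ := hQ p hp (biprod.inr ≫ f)
  exact ⟨biprod.desc a b, by ext <;> simp [ha, hb]⟩

lemma stableRel_add [HasFiniteBiproducts C] {X Y : C} {f₁ f₂ g₁ g₂ : X ⟶ Y}
    (h : stableRel E f₁ f₂) (h' : stableRel E g₁ g₂) :
    stableRel E (f₁ + g₁) (f₂ + g₂) := by
  have := hasBinaryBiproducts_of_finite_biproducts C
  obtain ⟨P, a, b, hP, hab⟩ := h
  obtain ⟨Q, c, d, hQ, hcd⟩ := h'
  refine ⟨P ⊞ Q, biprod.lift a c, biprod.desc b d, hP.biprod hQ, ?_⟩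
  rw [biprod.lift_desc, hab, hcd]
  abel

lemma stableRel_refl [HasFiniteBiproducts C] {X Y : C} (f : X ⟶ Y) : stableRel E f f := by
  have := hasZeroObject_of_hasFiniteBiproducts C
  exact ⟨_, 0, 0, IsProj.of_isZero (isZero_zero C), by simp⟩

variable (E)

instance stableRel_congruence [IsExactCategory E] : Congruence (stableRel E) where
  equivalence := by
    intro X Y
    have := IsExactCategory.hasFiniteBiproducts E
    refine ⟨fun f => stableRel_refl f, ?_, ?_⟩
    · rintro f g ⟨P, a, b, hP, hab⟩
      exact ⟨P, a, -b, hP, by simp [hab]⟩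
    · intro f g h h₁ h₂
      obtain ⟨P, a, b, hP, hab⟩ := stableRel_add h₁ h₂
      exact ⟨P, a, b, hP, by rw [hab]; abel⟩
  comp_left := by
    rintro X Y Z f g g' ⟨P, a, b, hP, hab⟩
    exact ⟨P, f ≫ a, b, hP, by simp [hab]⟩
  comp_right := by
    rintro X Y Z f f' g ⟨P, a, b, hP, hab⟩
    exact ⟨P, a, b ≫ g, hP, by rw [← Category.assoc, hab, Preadditive.sub_comp]⟩

noncomputable instance stablePreadditive [IsExactCategory E] :
    Preadditive (StableCategory E) :=
  CategoryTheory.Quotient.preadditive (stableRel E) (fun _ _ _ _ _ _ h h' => by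
    have := IsExactCategory.hasFiniteBiproducts E
    exact stableRel_add h h')

end Basic

/-! ## The suspension functor

For every object `X` a conflation `X ⟶ hull X ⟶ cosyz X` with `hull X` injective is chosen.
A morphism `f : X ⟶ Y` extends to a morphism of these conflations, and the induced morphism
`cosyz X ⟶ cosyz Y` is unique in the stable category. -/

section Suspension

variable {C : Type u} [Category.{v} C] [Preadditive C] (E : ObjectProperty (ShortComplex C))
  [IsFrobenius E]

/-- The chosen injective object containing `X`. -/
noncomputable def hull (X : C) : C := (IsFrobenius.enoughInj (E := E) X).choose

/-- The chosen inflation of `X` into an injective object. -/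
noncomputable def hullι (X : C) : X ⟶ hull E X :=
  (IsFrobenius.enoughInj (E := E) X).choose_spec.choose

lemma hull_inj (X : C) : IsInj E (hull E X) :=
  (IsFrobenius.enoughInj (E := E) X).choose_spec.choose_spec.1

lemma hullι_inflation (X : C) : IsInflation E (hullι E X) :=
  (IsFrobenius.enoughInj (E := E) X).choose_spec.choose_spec.2

/-- The cokernel of the chosen inflation. -/
noncomputable def cosyz (X : C) : C := (hullι_inflation E X).choose

/-- The chosen deflation onto the cokernel. -/
noncomputable def hullπ (X : C) : hull E X ⟶ cosyz E X :=
  (hullι_inflation E X).choose_spec.choose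

@[simp] lemma hullι_hullπ (X : C) : hullι E X ≫ hullπ E X = 0 :=
  (hullι_inflation E X).choose_spec.choose_spec.choose

lemma hull_conflation (X : C) :
    E (ShortComplex.mk (hullι E X) (hullπ E X) (hullι_hullπ E X)) :=
  (hullι_inflation E X).choose_spec.choose_spec.choose_spec

lemma cosyz_desc {X Z : C} (k : hull E X ⟶ Z) (hk : hullι E X ≫ k = 0) :
    ∃ l : cosyz E X ⟶ Z, hullπ E X ≫ l = k := by
  obtain ⟨h⟩ := IsExactCategory.isCokernel _ (hull_conflation E X)
  exact ⟨h.desc (CokernelCofork.ofπ k hk), h.fac _ WalkingParallelPair.one⟩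

lemma hullπ_cancel {X Z : C} {k l : cosyz E X ⟶ Z} (h : hullπ E X ≫ k = hullπ E X ≫ l) :
    k = l := by
  obtain ⟨hc⟩ := IsExactCategory.isCokernel _ (hull_conflation E X)
  exact Cofork.IsColimit.hom_ext hc h

lemma exists_cosyzMap {X Y : C} (f : X ⟶ Y) :
    ∃ (b : cosyz E X ⟶ cosyz E Y) (a : hull E X ⟶ hull E Y),
      hullι E X ≫ a = f ≫ hullι E Y ∧ hullπ E X ≫ b = a ≫ hullπ E Y := by
  obtain ⟨a, ha⟩ := hull_inj E Y (hullι E X) (hullι_inflation E X) (f ≫ hullι E Y)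
  obtain ⟨b, hb⟩ := cosyz_desc E (a ≫ hullπ E Y) (by rw [← Category.assoc, ha]; simp)
  exact ⟨b, a, ha, hb⟩

/-- The morphism induced on cokernels by a chosen extension of `f` to the injective objects. -/
noncomputable def cosyzMap {X Y : C} (f : X ⟶ Y) : cosyz E X ⟶ cosyz E Y :=
  (exists_cosyzMap E f).choose

lemma cosyzMap_spec {X Y : C} (f : X ⟶ Y) : ∃ a : hull E X ⟶ hull E Y,
    hullι E X ≫ a = f ≫ hullι E Y ∧ hullπ E X ≫ cosyzMap E f = a ≫ hullπ E Y :=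
  (exists_cosyzMap E f).choose_spec

/-- The induced morphism on cokernels depends, in the stable category, only on the class of `f`. -/
lemma cosyz_unique {X Y : C} {f f' : X ⟶ Y} (hf : stableRel E f f')
    {a a' : hull E X ⟶ hull E Y} {b b' : cosyz E X ⟶ cosyz E Y}
    (ha : hullι E X ≫ a = f ≫ hullι E Y) (hb : hullπ E X ≫ b = a ≫ hullπ E Y)
    (ha' : hullι E X ≫ a' = f' ≫ hullι E Y) (hb' : hullπ E X ≫ b' = a' ≫ hullπ E Y) :
    stableRel E b b' := by
  obtain ⟨P, c, d, hP, hcd⟩ := hf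
  obtain ⟨e, he⟩ := (IsFrobenius.proj_iff_inj (E := E) P).1 hP _ (hullι_inflation E X) c
  obtain ⟨l, hl⟩ := cosyz_desc E (a - a' - e ≫ d ≫ hullι E Y) (by
    simp only [Preadditive.comp_sub, ha, ha', reassoc_of% he, reassoc_of% hcd,
      Preadditive.sub_comp]
    abel)
  refine ⟨hull E Y, l, hullπ E Y, (IsFrobenius.proj_iff_inj _).2 (hull_inj E Y), ?_⟩
  apply hullπ_cancel E
  rw [reassoc_of% hl]
  simp [hb, hb']

/-- The suspension on `C`, with values in the stable category. -/
noncomputable def preSusp : C ⥤ StableCategory E where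
  obj X := (toStable E).obj (cosyz E X)
  map f := (toStable E).map (cosyzMap E f)
  map_id X := by
    obtain ⟨a, ha, hb⟩ := cosyzMap_spec E (𝟙 X)
    rw [← (toStable E).map_id]
    have := IsExactCategory.hasFiniteBiproducts E
    exact CategoryTheory.Quotient.sound _ (cosyz_unique E (stableRel_refl (𝟙 X)) ha hb
      (a' := 𝟙 _) (by simp) (by simp))
  map_comp {X Y Z} f g := by
    obtain ⟨a, ha, hb⟩ := cosyzMap_spec E f
    obtain ⟨a', ha', hb'⟩ := cosyzMap_spec E g
    obtain ⟨a'', ha'', hb''⟩ := cosyzMap_spec E (f ≫ g)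
    rw [← (toStable E).map_comp]
    have := IsExactCategory.hasFiniteBiproducts E
    exact CategoryTheory.Quotient.sound _ (cosyz_unique E (stableRel_refl (f ≫ g)) ha'' hb''
      (a' := a ≫ a') (by rw [reassoc_of% ha, ha', Category.assoc])
      (by rw [reassoc_of% hb, hb', Category.assoc]))

/-- The suspension functor of the stable category of a Frobenius category. -/
noncomputable def susp : StableCategory E ⥤ StableCategory E :=
  CategoryTheory.Quotient.lift (stableRel E) (preSusp E) (by
    intro X Y f g hfg
    obtain ⟨a, ha, hb⟩ := cosyzMap_spec E f
    obtain ⟨a', ha', hb'⟩ := cosyzMap_spec E g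
    exact CategoryTheory.Quotient.sound _ (cosyz_unique E hfg ha hb ha' hb'))

/-! ## Distinguished triangles and triangle functors -/

/-- The triangle `X ⟶ Y ⟶ Z ⟶ susp X` given by `u`, `v` and the class of `w` is a standard
triangle: `Z` is a push-out of `u` and the inflation `X ⟶ hull X`, and `w` is the morphism
induced by `0 : Y ⟶ cosyz X` and the deflation `hull X ⟶ cosyz X`. -/
def IsStandardTriangle {X Y Z : C} (u : X ⟶ Y) (v : Y ⟶ Z) (w : Z ⟶ cosyz E X) : Prop :=
  ∃ j : hull E X ⟶ Z, IsPushout u (hullι E X) v j ∧ v ≫ w = 0 ∧ j ≫ w = hullπ E X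

/-- A triangle of the stable category is distinguished if it is isomorphic, in the stable
category, to a standard triangle. -/
def IsDistinguished {A B D : StableCategory E} (f : A ⟶ B) (g : B ⟶ D)
    (h : D ⟶ (susp E).obj A) : Prop :=
  ∃ (X Y Z : C) (u : X ⟶ Y) (v : Y ⟶ Z) (w : Z ⟶ cosyz E X)
    (a : A ≅ (toStable E).obj X) (b : B ≅ (toStable E).obj Y) (d : D ≅ (toStable E).obj Z),
    IsStandardTriangle E u v w ∧
    f ≫ b.hom = a.hom ≫ (toStable E).map u ∧
    g ≫ d.hom = b.hom ≫ (toStable E).map v ∧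
    h ≫ (susp E).map a.hom = d.hom ≫ (toStable E).map w

end Suspension

/-- A triangle functor between the stable categories of two Frobenius categories: an additive
functor together with a natural isomorphism which makes it commute with the suspensions, such
that distinguished triangles are sent to distinguished triangles. -/
structure TriangleFunctor {C : Type*} [Category* C] [Preadditive C]
    (E : ObjectProperty (ShortComplex C)) [IsFrobenius E]
    {D : Type*} [Category* D] [Preadditive D]
    (E' : ObjectProperty (ShortComplex D)) [IsFrobenius E'] where
  functor : StableCategory E ⥤ StableCategory E'
  additive : functor.Additive
  commSusp : susp E ⋙ functor ≅ functor ⋙ susp E'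
  map_distinguished : ∀ {X Y Z : StableCategory E} (f : X ⟶ Y) (g : Y ⟶ Z)
    (h : Z ⟶ (susp E).obj X), IsDistinguished E f g h →
      IsDistinguished E' (functor.map f) (functor.map g) (functor.map h ≫ commSusp.hom.app X)

end QuillenExact

/-! ## The monomorphism category of projective modules -/

/-- The objects of `Mon(ω, 𝒫)` among all morphisms of `S`-modules: monomorphisms between
finitely generated projective modules whose cokernel is annihilated by `ω`. -/
def isMonProj (S : Type u) [CommRing S] (ω : S) : ObjectProperty (Arrow (ModuleCat.{u} S)) :=
  fun f =>
    (Module.Finite S f.left ∧ Module.Projective S f.left) ∧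
    (Module.Finite S f.right ∧ Module.Projective S f.right) ∧
    Mono f.hom ∧
    ∀ x : f.right ⧸ LinearMap.range f.hom.hom, ω • x = 0

/-- The category `Mon(ω, 𝒫)`, a full subcategory of the morphism category of `S`-modules. -/
abbrev MonProj (S : Type u) [CommRing S] (ω : S) := (isMonProj S ω).FullSubcategory

namespace MonProj

variable (S : Type u) [CommRing S] (ω : S)

/-- The functor `(P₁ ⟶ P₀) ↦ P₁`. -/
abbrev eval₁ : MonProj S ω ⥤ ModuleCat.{u} S := (isMonProj S ω).ι ⋙ Arrow.leftFunc

/-- The functor `(P₁ ⟶ P₀) ↦ P₀`. -/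
abbrev eval₀ : MonProj S ω ⥤ ModuleCat.{u} S := (isMonProj S ω).ι ⋙ Arrow.rightFunc

instance : (eval₁ S ω).Additive where
instance : (eval₀ S ω).Additive where

/-- The conflations of `Mon(ω, 𝒫)`: the sequences in `Mon(ω, 𝒫)` which are short exact
sequences in the morphism category, that is, short exact in both degrees. -/
def conflation : ObjectProperty (ShortComplex (MonProj S ω)) := fun T =>
  (T.map (eval₁ S ω)).ShortExact ∧ (T.map (eval₀ S ω)).ShortExact

end MonProj

/-! ## Matrix factorizations of projective modules -/

/-- A matrix factorization of `ω`: a pair of maps `ρ₁ : P₁ ⟶ P₀` and `ρ₀ : P₀ ⟶ P₁` between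
finitely generated projective modules, both compositions of which are multiplication by `ω`. -/
structure MatFac (S : Type u) [CommRing S] (ω : S) where
  P₁ : ModuleCat.{u} S
  P₀ : ModuleCat.{u} S
  ρ₁ : P₁ ⟶ P₀
  ρ₀ : P₀ ⟶ P₁
  finite₁ : Module.Finite S P₁
  projective₁ : Module.Projective S P₁
  finite₀ : Module.Finite S P₀
  projective₀ : Module.Projective S P₀
  ρ₁_ρ₀ : ρ₁ ≫ ρ₀ = ω • 𝟙 P₁
  ρ₀_ρ₁ : ρ₀ ≫ ρ₁ = ω • 𝟙 P₀

namespace MatFac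

section Category

variable {S : Type u} [CommRing S] {ω : S}

/-- Morphisms of matrix factorizations. -/
@[ext]
structure Hom (X Y : MatFac S ω) where
  φ₁ : X.P₁ ⟶ Y.P₁
  φ₀ : X.P₀ ⟶ Y.P₀
  comm₁ : X.ρ₁ ≫ φ₀ = φ₁ ≫ Y.ρ₁
  comm₀ : X.ρ₀ ≫ φ₁ = φ₀ ≫ Y.ρ₀

instance : Category (MatFac S ω) where
  Hom := Hom
  id X := ⟨𝟙 _, 𝟙 _, by simp, by simp⟩
  comp f g := ⟨f.φ₁ ≫ g.φ₁, f.φ₀ ≫ g.φ₀,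
    by rw [← Category.assoc, f.comm₁, Category.assoc, g.comm₁, Category.assoc],
    by rw [← Category.assoc, f.comm₀, Category.assoc, g.comm₀, Category.assoc]⟩

@[ext]
lemma hom_ext {X Y : MatFac S ω} {f g : X ⟶ Y} (h₁ : f.φ₁ = g.φ₁) (h₀ : f.φ₀ = g.φ₀) : f = g :=
  Hom.ext h₁ h₀

@[simp] lemma id_φ₁ (X : MatFac S ω) : Hom.φ₁ (𝟙 X) = 𝟙 _ := rfl
@[simp] lemma id_φ₀ (X : MatFac S ω) : Hom.φ₀ (𝟙 X) = 𝟙 _ := rfl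
@[simp] lemma comp_φ₁ {X Y Z : MatFac S ω} (f : X ⟶ Y) (g : Y ⟶ Z) :
    (f ≫ g).φ₁ = f.φ₁ ≫ g.φ₁ := rfl
@[simp] lemma comp_φ₀ {X Y Z : MatFac S ω} (f : X ⟶ Y) (g : Y ⟶ Z) :
    (f ≫ g).φ₀ = f.φ₀ ≫ g.φ₀ := rfl

instance (X Y : MatFac S ω) : Zero (X ⟶ Y) := ⟨⟨0, 0, by simp, by simp⟩⟩
instance (X Y : MatFac S ω) : Add (X ⟶ Y) :=
  ⟨fun f g => ⟨f.φ₁ + g.φ₁, f.φ₀ + g.φ₀, by simp [f.comm₁, g.comm₁], by simp [f.comm₀, g.comm₀]⟩⟩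
instance (X Y : MatFac S ω) : Neg (X ⟶ Y) :=
  ⟨fun f => ⟨-f.φ₁, -f.φ₀, by simp [f.comm₁], by simp [f.comm₀]⟩⟩

@[simp] lemma zero_φ₁ (X Y : MatFac S ω) : Hom.φ₁ (0 : X ⟶ Y) = 0 := rfl
@[simp] lemma zero_φ₀ (X Y : MatFac S ω) : Hom.φ₀ (0 : X ⟶ Y) = 0 := rfl
@[simp] lemma add_φ₁ {X Y : MatFac S ω} (f g : X ⟶ Y) : (f + g).φ₁ = f.φ₁ + g.φ₁ := rfl
@[simp] lemma add_φ₀ {X Y : MatFac S ω} (f g : X ⟶ Y) : (f + g).φ₀ = f.φ₀ + g.φ₀ := rfl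
@[simp] lemma neg_φ₁ {X Y : MatFac S ω} (f : X ⟶ Y) : (-f).φ₁ = -f.φ₁ := rfl
@[simp] lemma neg_φ₀ {X Y : MatFac S ω} (f : X ⟶ Y) : (-f).φ₀ = -f.φ₀ := rfl

/-- Morphisms of matrix factorizations are added componentwise. -/
instance (X Y : MatFac S ω) : AddCommGroup (X ⟶ Y) where
  add_assoc f g h := by ext1 <;> simp [add_assoc]
  zero_add f := by ext1 <;> simp
  add_zero f := by ext1 <;> simp
  add_comm f g := by ext1 <;> simp [add_comm]
  neg_add_cancel f := by ext1 <;> simp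
  nsmul := nsmulRec
  zsmul := zsmulRec

instance : Preadditive (MatFac S ω) where
  add_comp _ _ _ f f' g := by ext1 <;> simp
  comp_add _ _ _ f g g' := by ext1 <;> simp

end Category

variable (S : Type u) [CommRing S] (ω : S)

/-- The functor `(P₁ ⇄ P₀) ↦ P₁`. -/
def eval₁ : MatFac S ω ⥤ ModuleCat.{u} S where
  obj X := X.P₁
  map f := f.φ₁

/-- The functor `(P₁ ⇄ P₀) ↦ P₀`. -/
def eval₀ : MatFac S ω ⥤ ModuleCat.{u} S where
  obj X := X.P₀
  map f := f.φ₀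

instance : (eval₁ S ω).Additive where
instance : (eval₀ S ω).Additive where

/-- The conflations of `MF(ω, 𝒫)`: the sequences which are short exact in both degrees. -/
def conflation : ObjectProperty (ShortComplex (MatFac S ω)) := fun T =>
  (T.map (eval₁ S ω)).ShortExact ∧ (T.map (eval₀ S ω)).ShortExact

end MatFac

/-! The equivalence exists before passing to stable categories. If `f : P₁ ⟶ P₀` is a monomorphism
and `ω` kills its cokernel, then `ω • P₀` lies in the image of `f`, so multiplication by `ω` on `P₀`
factors uniquely through `f`. This factorization is the missing map `ρ₀` (`exists_matFac`).
Conversely `ω` acts injectively on projective modules, so `ρ₁` is always a monomorphism (`mono_ρ₁`).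
Cancelling it shows that a square commuting with `ρ₁` also commutes with `ρ₀`. Hence forgetting `ρ₀`
is an equivalence `toMonProj`, and it matches conflations because it leaves both modules unchanged
(`conflation_inv_iff`).

The rest is formal. `MatFac` is shown to be Frobenius directly: its conflations split in each
degree, and the factorizations `(𝟙, ω)` and `(ω, 𝟙)` supply the projective-injective objects. An
additive equivalence that preserves and reflects conflations transports the Frobenius structure to
`MonProj` and induces an equivalence of stable categories. This equivalence is a triangle functor
because suspensions and cones depend on the chosen injective hulls only up to stable isomorphism
(`stableRel_of_conflation`, `stableRel_pushout`). -/

namespace QuillenExact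

/-! ### Independence of the chosen hulls in the stable category. -/

section Stable

variable {C : Type u} [Category.{v} C] [Preadditive C] {E : ObjectProperty (ShortComplex C)}

lemma IsInflation.of_iso [E.IsClosedUnderIsomorphisms] {X Y X' Y' : C} {i : X ⟶ Y} {i' : X' ⟶ Y'}
    (h : IsInflation E i) (e : X ≅ X') (e' : Y ≅ Y') (w : i ≫ e'.hom = e.hom ≫ i') :
    IsInflation E i' := by
  obtain ⟨Z, p, hp, hE⟩ := h
  have hi : i' = e.inv ≫ i ≫ e'.hom := by rw [w, Iso.inv_hom_id_assoc]
  refine ⟨Z, e'.inv ≫ p, by simp [hi, hp], E.prop_of_iso ?_ hE⟩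
  exact ShortComplex.isoMk e e' (Iso.refl _) (by simp [w]) (by simp)

lemma IsDeflation.of_iso [E.IsClosedUnderIsomorphisms] {X Y X' Y' : C} {p : X ⟶ Y} {p' : X' ⟶ Y'}
    (h : IsDeflation E p) (e : X ≅ X') (e' : Y ≅ Y') (w : p ≫ e'.hom = e.hom ≫ p') :
    IsDeflation E p' := by
  obtain ⟨Z, i, hi, hE⟩ := h
  have hp : p' = e.inv ≫ p ≫ e'.hom := by rw [w, Iso.inv_hom_id_assoc]
  refine ⟨Z, i ≫ e.hom, by simp [hp, reassoc_of% hi], E.prop_of_iso ?_ hE⟩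
  exact ShortComplex.isoMk (Iso.refl _) e e' (by simp) (by simp [w])

lemma IsProj.of_retract {P Q : C} (hP : IsProj E P) (i : Q ⟶ P) (r : P ⟶ Q) (h : i ≫ r = 𝟙 Q) :
    IsProj E Q := fun Y Z p hp f => by
  obtain ⟨g, hg⟩ := hP p hp (r ≫ f)
  exact ⟨i ≫ g, by rw [Category.assoc, hg, reassoc_of% h]⟩

lemma IsInj.of_retract {P Q : C} (hP : IsInj E P) (i : Q ⟶ P) (r : P ⟶ Q) (h : i ≫ r = 𝟙 Q) :
    IsInj E Q := fun Y Z p hp f => by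
  obtain ⟨g, hg⟩ := hP p hp (f ≫ i)
  exact ⟨g ≫ r, by rw [reassoc_of% hg, h, Category.comp_id]⟩

lemma IsInj.biprod {P Q : C} [HasBinaryBiproduct P Q] (hP : IsInj E P) (hQ : IsInj E Q) :
    IsInj E (P ⊞ Q) := by
  intro Y Z p hp f
  obtain ⟨a, ha⟩ := hP p hp (f ≫ biprod.fst)
  obtain ⟨b, hb⟩ := hQ p hp (f ≫ biprod.snd)
  exact ⟨biprod.lift a b, by ext <;> simp [ha, hb]⟩

lemma conflation_desc [IsExactCategory E] {X I Q : C} {i : X ⟶ I} {p : I ⟶ Q} {w : i ≫ p = 0}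
    (hT : E (ShortComplex.mk i p w)) {Z : C} (k : I ⟶ Z) (hk : i ≫ k = 0) :
    ∃ l : Q ⟶ Z, p ≫ l = k := by
  obtain ⟨h⟩ := IsExactCategory.isCokernel _ hT
  exact ⟨h.desc (CokernelCofork.ofπ k hk), h.fac _ WalkingParallelPair.one⟩

lemma conflation_cancel [IsExactCategory E] {X I Q : C} {i : X ⟶ I} {p : I ⟶ Q} {w : i ≫ p = 0}
    (hT : E (ShortComplex.mk i p w)) {Z : C} {k l : Q ⟶ Z} (h : p ≫ k = p ≫ l) : k = l := by
  obtain ⟨hc⟩ := IsExactCategory.isCokernel _ hT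
  exact Cofork.IsColimit.hom_ext hc h

/-- The morphism induced on the cokernels of two conflations, the second one having an injective
middle term, depends in the stable category only on the class of the given morphism. -/
lemma stableRel_of_conflation [IsFrobenius E] {X I Q X' I' Q' : C} {i : X ⟶ I} {p : I ⟶ Q}
    {w : i ≫ p = 0} (hT : E (ShortComplex.mk i p w)) {i' : X' ⟶ I'} {p' : I' ⟶ Q'}
    (w' : i' ≫ p' = 0) (hI : IsInj E I') {f f' : X ⟶ X'} (hf : stableRel E f f')
    {a a' : I ⟶ I'} {b b' : Q ⟶ Q'} (ha : i ≫ a = f ≫ i') (hb : p ≫ b = a ≫ p')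
    (ha' : i ≫ a' = f' ≫ i') (hb' : p ≫ b' = a' ≫ p') :
    stableRel E b b' := by
  obtain ⟨P, c, d, hP, hcd⟩ := hf
  -- `P` is also injective, so `c` extends along `i` to `e`. Then `a - a' - e ≫ d ≫ i'` vanishes on
  -- `X` and descends to `l : Q ⟶ I'`, and `b - b' = l ≫ p'` factors through `I'`.
  obtain ⟨e, he⟩ := (IsFrobenius.proj_iff_inj (E := E) P).1 hP i ⟨_, _, w, hT⟩ c
  obtain ⟨l, hl⟩ := conflation_desc hT (a - a' - e ≫ d ≫ i') (by
    simp only [Preadditive.comp_sub, ha, ha', reassoc_of% he, reassoc_of% hcd,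
      Preadditive.sub_comp]
    abel)
  refine ⟨_, l, p', (IsFrobenius.proj_iff_inj _).2 hI, ?_⟩
  apply conflation_cancel hT
  rw [reassoc_of% hl]
  simp [hb, hb', w']

/-- An endomorphism of a push-out along an inflation into an injective object `I` is stably the
identity if it is induced by the identity and an endomorphism of `I`. -/
lemma stableRel_pushout [IsFrobenius E] {X I Q : C} {i : X ⟶ I} {p : I ⟶ Q} {w₀ : i ≫ p = 0}
    (hT : E (ShortComplex.mk i p w₀)) (hI : IsInj E I)
    {Y Z : C} {u : X ⟶ Y} {v : Y ⟶ Z} {j : I ⟶ Z} (h : IsPushout u i v j)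
    {w : Z ⟶ Q} (hw : v ≫ w = 0) (hjw : j ≫ w = p) {a : I ⟶ I} (ha : i ≫ a = i)
    {φ : Z ⟶ Z} (hφ : v ≫ φ = v) (hjφ : j ≫ φ = a ≫ j) : stableRel E φ (𝟙 Z) := by
  -- Since `a - 𝟙` kills `i`, it equals `p ≫ l`. Then `φ - 𝟙` and `w ≫ l ≫ j` agree after `v` (both
  -- vanish) and after `j`.
  obtain ⟨l, hl⟩ := conflation_desc hT (a - 𝟙 _) (by simp [ha])
  refine ⟨_, w ≫ l, j, (IsFrobenius.proj_iff_inj _).2 hI, ?_⟩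
  apply h.hom_ext
  · simp [reassoc_of% hw, hφ]
  · simp [reassoc_of% hjw, reassoc_of% hl, hjφ]

end Stable

/-! ### Transport of Frobenius structures and triangles along an equivalence. -/

section Transport

variable {C : Type*} [Category* C] [Preadditive C] {E : ObjectProperty (ShortComplex C)}
  {D : Type*} [Category* D] [Preadditive D] {E' : ObjectProperty (ShortComplex D)}
  (F : C ⥤ D) [F.Additive] [F.IsEquivalence]

section

variable [E'.IsClosedUnderIsomorphisms] {F}

/-- A conflation starting with `F.map i` need not have its third object in the image of `F`.
Replacing that object by its preimage alters the conflation only by an isomorphism, under which `E'`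
is closed. -/
lemma isInflation_map_iff (hE : ∀ T, E T ↔ E' (T.map F)) {X Y : C} (i : X ⟶ Y) :
    IsInflation E' (F.map i) ↔ IsInflation E i := by
  constructor
  · rintro ⟨Z, p, w, h⟩
    have hz : i ≫ F.preimage (p ≫ (F.objObjPreimageIso Z).inv) = 0 :=
      F.map_injective (by simp [reassoc_of% w])
    refine ⟨F.objPreimage Z, F.preimage (p ≫ (F.objObjPreimageIso Z).inv), hz, ?_⟩
    rw [hE]
    refine E'.prop_of_iso ?_ h
    exact ShortComplex.isoMk (Iso.refl _) (Iso.refl _) (F.objObjPreimageIso Z).symm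
      ((Category.id_comp _).trans (Category.comp_id _).symm)
      ((Category.id_comp _).trans (F.map_preimage _))
  · rintro ⟨Z, p, w, h⟩
    exact ⟨F.obj Z, F.map p, by rw [← F.map_comp, w, F.map_zero], (hE _).1 h⟩

lemma isDeflation_map_iff (hE : ∀ T, E T ↔ E' (T.map F)) {X Y : C} (p : X ⟶ Y) :
    IsDeflation E' (F.map p) ↔ IsDeflation E p := by
  constructor
  · rintro ⟨Z, i, w, h⟩
    have hz : F.preimage ((F.objObjPreimageIso Z).hom ≫ i) ≫ p = 0 :=
      F.map_injective (by simp [w])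
    refine ⟨F.objPreimage Z, F.preimage ((F.objObjPreimageIso Z).hom ≫ i), hz, ?_⟩
    rw [hE]
    refine E'.prop_of_iso ?_ h
    exact ShortComplex.isoMk (F.objObjPreimageIso Z).symm (Iso.refl _) (Iso.refl _)
      (((F.objObjPreimageIso Z).inv ≫= F.map_preimage _).trans
        ((Iso.inv_hom_id_assoc _ _).trans (Category.comp_id _).symm))
      ((Category.id_comp _).trans (Category.comp_id _).symm)
  · rintro ⟨Z, i, w, h⟩
    exact ⟨F.obj Z, F.map i, by rw [← F.map_comp, w, F.map_zero], (hE _).1 h⟩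

lemma isProj_map_iff (hE : ∀ T, E T ↔ E' (T.map F)) (P : C) :
    IsProj E' (F.obj P) ↔ IsProj E P := by
  constructor
  · intro h Y Z p hp f
    obtain ⟨g, hg⟩ := h (F.map p) ((isDeflation_map_iff hE p).2 hp) (F.map f)
    exact ⟨F.preimage g, F.map_injective (by simpa using hg)⟩
  · intro h Y Z p hp f
    let eY := F.objObjPreimageIso Y
    let eZ := F.objObjPreimageIso Z
    obtain ⟨g, hg⟩ := h (F.preimage (eY.hom ≫ p ≫ eZ.inv))
      ((isDeflation_map_iff hE _).1 (hp.of_iso eY.symm eZ.symm (by simp)))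
      (F.preimage (f ≫ eZ.inv))
    refine ⟨F.map g ≫ eY.hom, ?_⟩
    have := congr_arg F.map hg
    rw [F.map_comp, F.map_preimage, F.map_preimage] at this
    rw [← cancel_mono eZ.inv]
    simpa using this

lemma isInj_map_iff (hE : ∀ T, E T ↔ E' (T.map F)) (P : C) :
    IsInj E' (F.obj P) ↔ IsInj E P := by
  constructor
  · intro h Y Z p hp f
    obtain ⟨g, hg⟩ := h (F.map p) ((isInflation_map_iff hE p).2 hp) (F.map f)
    exact ⟨F.preimage g, F.map_injective (by simpa using hg)⟩
  · intro h Y Z p hp f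
    let eY := F.objObjPreimageIso Y
    let eZ := F.objObjPreimageIso Z
    obtain ⟨g, hg⟩ := h (F.preimage (eY.hom ≫ p ≫ eZ.inv))
      ((isInflation_map_iff hE _).1 (hp.of_iso eY.symm eZ.symm (by simp)))
      (F.preimage (eY.hom ≫ f))
    refine ⟨eZ.inv ≫ F.map g, ?_⟩
    have := congr_arg F.map hg
    rw [F.map_comp, F.map_preimage, F.map_preimage] at this
    rw [← cancel_epi eY.hom]
    simpa using this

end

/-- An exact structure which corresponds to a given one under an additive equivalence. -/
lemma IsExactCategory.of_equivalence [IsExactCategory E'] (hE : ∀ T, E T ↔ E' (T.map F)) :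
    IsExactCategory E := by
  have := IsExactCategory.hasFiniteBiproducts E'
  have := IsExactCategory.closedUnderIso (E := E')
  refine
    { hasFiniteBiproducts := ?_
      closedUnderIso := ⟨fun {T T'} e h => ?_⟩
      isKernel := fun T hT => ?_
      isCokernel := fun T hT => ?_
      inflation_id := fun X => ?_
      deflation_id := fun X => ?_
      inflation_comp := fun i j hi hj => ?_
      deflation_comp := fun i j hi hj => ?_
      inflation_pushout := fun {X Y X'} i f hi => ?_
      deflation_pullback := fun {Y Z Z'} p g hp => ?_ }
  · have : HasFiniteProducts C :=
      ⟨fun _ => Adjunction.hasLimitsOfShape_of_equivalence F⟩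
    exact HasFiniteBiproducts.of_hasFiniteProducts
  · rw [hE] at h ⊢
    exact E'.prop_of_iso (F.mapShortComplex.mapIso e) h
  · obtain ⟨h⟩ := IsExactCategory.isKernel _ ((hE T).1 hT)
    exact ⟨isLimitOfReflects F ((KernelFork.isLimitMapConeEquiv _ F).symm h)⟩
  · obtain ⟨h⟩ := IsExactCategory.isCokernel _ ((hE T).1 hT)
    exact ⟨isColimitOfReflects F ((CokernelCofork.isColimitMapCoconeEquiv _ F).symm h)⟩
  · rw [← isInflation_map_iff hE, F.map_id]
    exact IsExactCategory.inflation_id _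
  · rw [← isDeflation_map_iff hE, F.map_id]
    exact IsExactCategory.deflation_id _
  · rw [← isInflation_map_iff hE] at hi hj ⊢
    rw [F.map_comp]
    exact IsExactCategory.inflation_comp _ _ hi hj
  · rw [← isDeflation_map_iff hE] at hi hj ⊢
    rw [F.map_comp]
    exact IsExactCategory.deflation_comp _ _ hi hj
  · obtain ⟨Y', f', i', h, hi'⟩ :=
      IsExactCategory.inflation_pushout (F.map i) (F.map f) ((isInflation_map_iff hE i).2 hi)
    let e := F.objObjPreimageIso Y'
    refine ⟨F.objPreimage Y', F.preimage (f' ≫ e.inv), F.preimage (i' ≫ e.inv), ?_, ?_⟩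
    · refine IsPushout.of_map_of_faithful F ?_
      exact IsPushout.of_iso h (Iso.refl _) (Iso.refl _) (Iso.refl _) e.symm
        (by simp) (by simp) (by simp) (by simp)
    · rw [← isInflation_map_iff hE]
      exact hi'.of_iso (Iso.refl _) e.symm (by simp)
  · obtain ⟨Y', g', p', h, hp'⟩ :=
      IsExactCategory.deflation_pullback (F.map p) (F.map g) ((isDeflation_map_iff hE p).2 hp)
    let e := F.objObjPreimageIso Y'
    refine ⟨F.objPreimage Y', F.preimage (e.hom ≫ g'), F.preimage (e.hom ≫ p'), ?_, ?_⟩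
    · refine IsPullback.of_map_of_faithful F ?_
      exact IsPullback.of_iso h e.symm (Iso.refl _) (Iso.refl _) (Iso.refl _)
        (by simp) (by simp) (by simp) (by simp)
    · rw [← isDeflation_map_iff hE]
      exact hp'.of_iso e.symm (Iso.refl _) (by simp)

/-- A Frobenius structure which corresponds to a given one under an additive equivalence. -/
lemma IsFrobenius.of_equivalence [IsFrobenius E'] (hE : ∀ T, E T ↔ E' (T.map F)) :
    IsFrobenius E := by
  have := IsExactCategory.closedUnderIso (E := E')
  refine { IsExactCategory.of_equivalence F hE with
    enoughProj := fun X => ?_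
    enoughInj := fun X => ?_
    proj_iff_inj := fun X => ?_ }
  · obtain ⟨P, p, hP, hp⟩ := IsFrobenius.enoughProj (E := E') (F.obj X)
    let e := F.objObjPreimageIso P
    refine ⟨F.objPreimage P, F.preimage (e.hom ≫ p), ?_, ?_⟩
    · rw [← isProj_map_iff hE]
      exact hP.of_retract e.hom e.inv (by simp)
    · rw [← isDeflation_map_iff hE]
      exact hp.of_iso e.symm (Iso.refl _) (by simp)
  · obtain ⟨P, p, hP, hp⟩ := IsFrobenius.enoughInj (E := E') (F.obj X)
    let e := F.objObjPreimageIso P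
    refine ⟨F.objPreimage P, F.preimage (p ≫ e.inv), ?_, ?_⟩
    · rw [← isInj_map_iff hE]
      exact hP.of_retract e.hom e.inv (by simp)
    · rw [← isInflation_map_iff hE]
      exact hp.of_iso (Iso.refl _) e.symm (by simp)
  · rw [← isProj_map_iff hE, ← isInj_map_iff hE, IsFrobenius.proj_iff_inj]

-- The implication from right to left makes the induced functor on stable categories well defined;
-- the other one makes it faithful.
variable {F} in
lemma stableRel_map_iff [IsFrobenius E'] (hE : ∀ T, E T ↔ E' (T.map F)) {X Y : C} (f g : X ⟶ Y) :
    stableRel E' (F.map f) (F.map g) ↔ stableRel E f g := by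
  have := IsExactCategory.closedUnderIso (E := E')
  constructor
  · rintro ⟨P, a, b, hP, h⟩
    let e := F.objObjPreimageIso P
    refine ⟨F.objPreimage P, F.preimage (a ≫ e.inv), F.preimage (e.hom ≫ b), ?_, ?_⟩
    · rw [← isProj_map_iff hE]
      exact hP.of_retract e.hom e.inv (by simp)
    · exact F.map_injective (by simp [h])
  · rintro ⟨P, a, b, hP, h⟩
    exact ⟨F.obj P, F.map a, F.map b, (isProj_map_iff hE P).2 hP, by
      rw [← F.map_comp, h, F.map_sub]⟩

-- The image of the chosen hull of `X` is a second injective hull of `F.obj X`, in general different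
-- from the one chosen in `D`. Extending the identity of `F.obj X` in both directions gives the
-- comparison maps on cokernels.
omit [F.IsEquivalence] in
lemma map_hull_conflation [IsFrobenius E] (hE : ∀ T, E T ↔ E' (T.map F)) (X : C) :
    E' (ShortComplex.mk (F.map (hullι E X)) (F.map (hullπ E X))
      (by rw [← F.map_comp, hullι_hullπ, F.map_zero])) :=
  (hE _).1 (hull_conflation E X)

lemma map_hull_inj [IsFrobenius E] [IsFrobenius E'] (hE : ∀ T, E T ↔ E' (T.map F)) (X : C) : IsInj E' (F.obj (hull E X)) := by
  have := IsExactCategory.closedUnderIso (E := E')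
  exact (isInj_map_iff hE _).2 (hull_inj E X)

omit [F.IsEquivalence] in
lemma exists_suspComparison [IsFrobenius E] [IsFrobenius E']
    (hE : ∀ T, E T ↔ E' (T.map F)) (X : C) :
    ∃ (c : F.obj (cosyz E X) ⟶ cosyz E' (F.obj X)) (a : F.obj (hull E X) ⟶ hull E' (F.obj X)),
      F.map (hullι E X) ≫ a = hullι E' (F.obj X) ∧
      F.map (hullπ E X) ≫ c = a ≫ hullπ E' (F.obj X) := by
  have hT := map_hull_conflation F hE X
  obtain ⟨a, ha⟩ := hull_inj E' (F.obj X) _ ⟨_, _, _, hT⟩ (hullι E' (F.obj X))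
  obtain ⟨c, hc⟩ := conflation_desc hT (a ≫ hullπ E' (F.obj X))
    (by rw [reassoc_of% ha, hullι_hullπ])
  exact ⟨c, a, ha, hc⟩

lemma exists_suspComparison_inv [IsFrobenius E] [IsFrobenius E']
    (hE : ∀ T, E T ↔ E' (T.map F)) (X : C) :
    ∃ (c : cosyz E' (F.obj X) ⟶ F.obj (cosyz E X)) (a : hull E' (F.obj X) ⟶ F.obj (hull E X)),
      hullι E' (F.obj X) ≫ a = F.map (hullι E X) ∧
      hullπ E' (F.obj X) ≫ c = a ≫ F.map (hullπ E X) := by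
  obtain ⟨a, ha⟩ := map_hull_inj F hE X _ (hullι_inflation E' (F.obj X)) (F.map (hullι E X))
  obtain ⟨c, hc⟩ := cosyz_desc E' (a ≫ F.map (hullπ E X))
    (by rw [reassoc_of% ha, ← F.map_comp, hullι_hullπ, F.map_zero])
  exact ⟨c, a, ha, hc⟩

variable [IsFrobenius E'] (hE : ∀ T, E T ↔ E' (T.map F))

/-- The functor induced on stable categories by an equivalence which respects conflations. -/
def stableFunctor : StableCategory E ⥤ StableCategory E' :=
  CategoryTheory.Quotient.lift (stableRel E) (F ⋙ toStable E') (fun _ _ f g h =>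
    CategoryTheory.Quotient.sound _ ((stableRel_map_iff hE f g).2 h))

lemma stableFunctor_map {X Y : C} (f : X ⟶ Y) :
    (stableFunctor F hE).map ((toStable E).map f) = (toStable E').map (F.map f) := rfl

lemma toStable_add [IsExactCategory E] {X Y : C} (f g : X ⟶ Y) :
    (toStable E).map (f + g) = (toStable E).map f + (toStable E).map g := rfl

lemma stableFunctor_additive [IsFrobenius E] : (stableFunctor F hE).Additive where
  map_add {X Y f g} := by
    obtain ⟨f, rfl⟩ := (toStable E).map_surjective (X := X.as) (Y := Y.as) f
    obtain ⟨g, rfl⟩ := (toStable E).map_surjective (X := X.as) (Y := Y.as) g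
    rw [← toStable_add, stableFunctor_map, F.map_add, toStable_add]
    rfl

lemma stableFunctor_isEquivalence [IsFrobenius E] : (stableFunctor F hE).IsEquivalence where
  faithful := ⟨fun {X Y f g} h => by
    obtain ⟨f, rfl⟩ := (toStable E).map_surjective (X := X.as) (Y := Y.as) f
    obtain ⟨g, rfl⟩ := (toStable E).map_surjective (X := X.as) (Y := Y.as) g
    rw [stableFunctor_map, stableFunctor_map] at h
    exact CategoryTheory.Quotient.sound _ ((stableRel_map_iff hE f g).1
      ((CategoryTheory.Quotient.functor_map_eq_iff _ _ _).1 h))⟩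
  full := ⟨fun {X Y} f => by
    obtain ⟨f, rfl⟩ := (toStable E').map_surjective (X := F.obj X.as) (Y := F.obj Y.as) f
    exact ⟨(toStable E).map (F.preimage f), by rw [stableFunctor_map, F.map_preimage]⟩⟩
  essSurj := ⟨fun X => ⟨(toStable E).obj (F.objPreimage X.as),
    ⟨(toStable E').mapIso (F.objObjPreimageIso X.as)⟩⟩⟩


variable [IsFrobenius E]

/-- The comparison between the image of a suspension and the suspension of the image. -/
noncomputable def suspComparison (X : C) : F.obj (cosyz E X) ⟶ cosyz E' (F.obj X) :=
  (exists_suspComparison F hE X).choose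

omit [F.IsEquivalence] in
lemma suspComparison_spec (X : C) : ∃ a : F.obj (hull E X) ⟶ hull E' (F.obj X),
    F.map (hullι E X) ≫ a = hullι E' (F.obj X) ∧
    F.map (hullπ E X) ≫ suspComparison F hE X = a ≫ hullπ E' (F.obj X) :=
  (exists_suspComparison F hE X).choose_spec

/-- The inverse of the comparison, in the stable category. -/
noncomputable def suspComparisonInv (X : C) : cosyz E' (F.obj X) ⟶ F.obj (cosyz E X) :=
  (exists_suspComparison_inv F hE X).choose

lemma suspComparisonInv_spec (X : C) : ∃ a : hull E' (F.obj X) ⟶ F.obj (hull E X),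
    hullι E' (F.obj X) ≫ a = F.map (hullι E X) ∧
    hullπ E' (F.obj X) ≫ suspComparisonInv F hE X = a ≫ F.map (hullπ E X) :=
  (exists_suspComparison_inv F hE X).choose_spec

/-- The comparison as an isomorphism of the stable category. -/
noncomputable def suspIso (X : C) :
    (toStable E').obj (F.obj (cosyz E X)) ≅ (toStable E').obj (cosyz E' (F.obj X)) where
  hom := (toStable E').map (suspComparison F hE X)
  inv := (toStable E').map (suspComparisonInv F hE X)
  hom_inv_id := by
    have := IsExactCategory.hasFiniteBiproducts E'
    obtain ⟨a, ha, hc⟩ := suspComparison_spec F hE X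
    obtain ⟨a', ha', hc'⟩ := suspComparisonInv_spec F hE X
    rw [← Functor.map_comp, ← (toStable E').map_id]
    -- The composite and the identity are both induced on cokernels by `𝟙 (F.obj X)`, hence stably
    -- equal.
    exact CategoryTheory.Quotient.sound _
      (stableRel_of_conflation (map_hull_conflation F hE X)
        (by rw [← F.map_comp, hullι_hullπ, F.map_zero])
        (map_hull_inj F hE X) (stableRel_refl (𝟙 (F.obj X))) (a := a ≫ a') (a' := 𝟙 _)
        (by rw [reassoc_of% ha, ha', Category.id_comp])
        (by rw [reassoc_of% hc, hc', Category.assoc])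
        ((Category.comp_id _).trans (Category.id_comp _).symm)
        ((Category.comp_id _).trans (Category.id_comp _).symm))
  inv_hom_id := by
    have := IsExactCategory.hasFiniteBiproducts E'
    obtain ⟨a, ha, hc⟩ := suspComparison_spec F hE X
    obtain ⟨a', ha', hc'⟩ := suspComparisonInv_spec F hE X
    rw [← Functor.map_comp, ← (toStable E').map_id]
    exact CategoryTheory.Quotient.sound _
      (cosyz_unique E' (stableRel_refl (𝟙 (F.obj X))) (a := a' ≫ a) (a' := 𝟙 _)
        (by rw [reassoc_of% ha', ha, Category.id_comp])
        (by rw [reassoc_of% hc', hc, Category.assoc]) (by simp) (by simp))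

lemma suspIso_naturality {X Y : C} (f : X ⟶ Y) :
    (toStable E').map (F.map (cosyzMap E f)) ≫ (suspIso F hE Y).hom =
      (suspIso F hE X).hom ≫ (toStable E').map (cosyzMap E' (F.map f)) := by
  have := IsExactCategory.hasFiniteBiproducts E'
  obtain ⟨a, ha, hc⟩ := suspComparison_spec F hE X
  obtain ⟨a', ha', hc'⟩ := suspComparison_spec F hE Y
  obtain ⟨b, hb, hd⟩ := cosyzMap_spec E f
  obtain ⟨b', hb', hd'⟩ := cosyzMap_spec E' (F.map f)
  dsimp only [suspIso]
  rw [← Functor.map_comp, ← Functor.map_comp]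
  -- Both composites are induced by `F.map f`, through two different maps of hulls.
  refine CategoryTheory.Quotient.sound _
    (stableRel_of_conflation (map_hull_conflation F hE X) (hullι_hullπ E' (F.obj Y))
      (hull_inj E' _) (stableRel_refl (F.map f)) (a := F.map b ≫ a') (a' := a ≫ b')
      ?_ ?_ ?_ ?_)
  · rw [← F.map_comp_assoc, hb, F.map_comp, Category.assoc, ha']
  · rw [← F.map_comp_assoc, hd, F.map_comp, Category.assoc, hc', Category.assoc]
  · rw [reassoc_of% ha, hb']
  · rw [reassoc_of% hc, hd', Category.assoc]

/-- The induced functor on stable categories commutes with the suspensions. -/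
noncomputable def stableFunctorCommSusp :
    susp E ⋙ stableFunctor F hE ≅ stableFunctor F hE ⋙ susp E' :=
  CategoryTheory.Quotient.natIsoLift (stableRel E)
    (NatIso.ofComponents (fun X => suspIso F hE X) (fun f => suspIso_naturality F hE f))

/-- The image of a standard triangle is isomorphic to a standard triangle. -/
lemma exists_standardTriangle {X Y Z : C} {u : X ⟶ Y} {v : Y ⟶ Z} {w : Z ⟶ cosyz E X}
    (h : IsStandardTriangle E u v w) :
    ∃ (Z' : D) (v' : F.obj Y ⟶ Z') (w' : Z' ⟶ cosyz E' (F.obj X))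
      (φ : (toStable E').obj (F.obj Z) ≅ (toStable E').obj Z'),
      IsStandardTriangle E' (F.map u) v' w' ∧
      (toStable E').map (F.map v) ≫ φ.hom = (toStable E').map v' ∧
      (toStable E').map (F.map w) ≫ (suspIso F hE X).hom = φ.hom ≫ (toStable E').map w' := by
  obtain ⟨j, hZ, hvw, hjw⟩ := h
  have hFZ := hZ.map F
  -- `F.obj Z` is a push-out along the image of the hull of `X`, whereas a standard triangle needs
  -- the hull chosen in `D`, so the cone is formed anew.
  obtain ⟨Z', j', v', hZ', -⟩ := IsExactCategory.inflation_pushout (E := E')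
    (hullι E' (F.obj X)) (F.map u) (hullι_inflation E' _)
  replace hZ' := hZ'.flip
  obtain ⟨a, ha, hc⟩ := suspComparison_spec F hE X
  obtain ⟨a', ha', -⟩ := suspComparisonInv_spec F hE X
  let w' := hZ'.desc 0 (hullπ E' (F.obj X)) (by simp)
  have hvw' : v' ≫ w' = 0 := hZ'.inl_desc _ _ _
  have hjw' : j' ≫ w' = hullπ E' (F.obj X) := hZ'.inr_desc _ _ _
  -- `φ` and `ψ` glue the identity of `F.obj Y` with the two comparisons of hulls. Their composites
  -- are induced by endomorphisms of a hull fixing `F.obj X`, so `stableRel_pushout` makes them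
  -- stably inverse.
  let φ := hFZ.desc v' (a ≫ j') (by rw [reassoc_of% ha, hZ'.w])
  have hφ₁ : F.map v ≫ φ = v' := hFZ.inl_desc _ _ _
  have hφ₂ : F.map j ≫ φ = a ≫ j' := hFZ.inr_desc _ _ _
  let ψ := hZ'.desc (F.map v) (a' ≫ F.map j) (by rw [reassoc_of% ha', hFZ.w])
  have hψ₁ : v' ≫ ψ = F.map v := hZ'.inl_desc _ _ _
  have hψ₂ : j' ≫ ψ = a' ≫ F.map j := hZ'.inr_desc _ _ _
  refine ⟨Z', v', w', ⟨(toStable E').map φ, (toStable E').map ψ, ?_, ?_⟩,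
    ⟨j', hZ', hvw', hjw'⟩, ?_, ?_⟩
  · rw [← Functor.map_comp, ← (toStable E').map_id]
    exact CategoryTheory.Quotient.sound _
      (stableRel_pushout (map_hull_conflation F hE X) (map_hull_inj F hE X) hFZ
        (w := F.map w) (by rw [← F.map_comp, hvw, F.map_zero])
        (by rw [← F.map_comp, hjw]) (a := a ≫ a')
        (by rw [reassoc_of% ha, ha']) (by rw [reassoc_of% hφ₁, hψ₁])
        (by rw [reassoc_of% hφ₂, hψ₂, Category.assoc]))
  · rw [← Functor.map_comp, ← (toStable E').map_id]
    exact CategoryTheory.Quotient.sound _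
      (stableRel_pushout (hull_conflation E' (F.obj X)) (hull_inj E' _) hZ'
        (w := w') hvw' hjw' (a := a' ≫ a)
        (by rw [reassoc_of% ha', ha]) (by rw [reassoc_of% hψ₁, hφ₁])
        (by rw [reassoc_of% hψ₂, hφ₂, Category.assoc]))
  · rw [← Functor.map_comp, hφ₁]
  · dsimp only [suspIso]
    rw [← Functor.map_comp, ← Functor.map_comp]
    congr 1
    apply hFZ.hom_ext
    · rw [reassoc_of% hφ₁, hvw', ← F.map_comp_assoc, hvw, F.map_zero, zero_comp]
    · rw [reassoc_of% hφ₂, hjw', ← F.map_comp_assoc, hjw, hc]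

/-- The image of the isomorphism to a standard triangle is corrected in its third component by the
comparison of cones `φ`. The last square also needs naturality of `stableFunctorCommSusp`. -/
lemma stableFunctor_map_distinguished {X Y Z : StableCategory E} (f : X ⟶ Y) (g : Y ⟶ Z)
    (h : Z ⟶ (susp E).obj X) (hT : IsDistinguished E f g h) :
    IsDistinguished E' ((stableFunctor F hE).map f) ((stableFunctor F hE).map g)
      ((stableFunctor F hE).map h ≫ (stableFunctorCommSusp F hE).hom.app X) := by
  obtain ⟨X', Y', Z', u, v, w, a, b, d, hS, h₁, h₂, h₃⟩ := hT
  obtain ⟨Z'', v', w', φ, hS', hv, hw⟩ := exists_standardTriangle F hE hS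
  refine ⟨_, _, Z'', F.map u, v', w', (stableFunctor F hE).mapIso a,
    (stableFunctor F hE).mapIso b, (stableFunctor F hE).mapIso d ≪≫ φ, hS', ?_, ?_, ?_⟩
  · exact (Functor.map_comp _ _ _).symm.trans ((congr_arg _ h₁).trans (Functor.map_comp _ _ _))
  · have e : (stableFunctor F hE).map g ≫ (stableFunctor F hE).map d.hom = _ :=
      (Functor.map_comp _ _ _).symm.trans ((congr_arg _ h₂).trans (Functor.map_comp _ _ _))
    exact (Category.assoc _ _ _).symm.trans ((e =≫ φ.hom).trans ((Category.assoc _ _ _).trans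
      ((stableFunctor F hE).map b.hom ≫= hv)))
  · have hn := (stableFunctorCommSusp F hE).hom.naturality a.hom
    have e : (stableFunctor F hE).map h ≫ (stableFunctor F hE).map ((susp E).map a.hom) = _ :=
      (Functor.map_comp _ _ _).symm.trans ((congr_arg _ h₃).trans (Functor.map_comp _ _ _))
    exact (Category.assoc _ _ _).trans (((stableFunctor F hE).map h ≫= hn.symm).trans
      ((Category.assoc _ _ _).symm.trans ((e =≫ (suspIso F hE X').hom).trans
        ((Category.assoc _ _ _).trans (((stableFunctor F hE).map d.hom ≫= hw).trans
          (Category.assoc _ _ _).symm)))))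

/-- The triangle functor induced by an equivalence which respects conflations. -/
noncomputable def TriangleFunctor.ofEquivalence : TriangleFunctor E E' where
  functor := stableFunctor F hE
  additive := stableFunctor_additive F hE
  commSusp := stableFunctorCommSusp F hE
  map_distinguished := stableFunctor_map_distinguished F hE

end Transport

end QuillenExact

/-! ### Matrix factorizations form a Frobenius category. -/

namespace MatFac

open QuillenExact

variable {S : Type u} [CommRing S]

lemma finite_of_splitEpi {M N : ModuleCat.{u} S} (p : M ⟶ N) [IsSplitEpi p] [Module.Finite S M] :
    Module.Finite S N :=
  Module.Finite.of_surjective p.hom ((ModuleCat.epi_iff_surjective p).1 inferInstance)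

lemma projective_of_splitEpi {M N : ModuleCat.{u} S} (p : M ⟶ N) [IsSplitEpi p]
    [Module.Projective S M] : Module.Projective S N :=
  Module.Projective.of_split (section_ p).hom p.hom
    (congr_arg ModuleCat.Hom.hom (IsSplitEpi.id p))

instance isSplitEpi_cokernel_π {C : Type*} [Category* C] [Preadditive C] {X Y : C} (f : X ⟶ Y)
    [HasCokernel f] [IsSplitMono f] : IsSplitEpi (cokernel.π f) :=
  ⟨⟨cokernel.desc f (𝟙 Y - retraction f ≫ f) (by simp), by
    rw [← cancel_epi (cokernel.π f)]; simp⟩⟩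

instance isSplitMono_kernel_ι {C : Type*} [Category* C] [Preadditive C] {X Y : C} (f : X ⟶ Y)
    [HasKernel f] [IsSplitEpi f] : IsSplitMono (kernel.ι f) :=
  ⟨⟨kernel.lift f (𝟙 X - f ≫ section_ f) (by simp), by
    rw [← cancel_mono (kernel.ι f)]; simp⟩⟩

instance isSplitEpi_retraction {C : Type*} [Category* C] {X Y : C} (f : X ⟶ Y)
    [IsSplitMono f] : IsSplitEpi (retraction f) := ⟨⟨f, IsSplitMono.id f⟩⟩

lemma finite_biprod (M N : ModuleCat.{u} S) [Module.Finite S M] [Module.Finite S N] :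
    Module.Finite S (M ⊞ N : ModuleCat.{u} S) :=
  Module.Finite.equiv (ModuleCat.biprodIsoProd M N).symm.toLinearEquiv

lemma projective_biprod (M N : ModuleCat.{u} S) [Module.Projective S M] [Module.Projective S N] :
    Module.Projective S (M ⊞ N : ModuleCat.{u} S) :=
  Module.Projective.of_equiv (ModuleCat.biprodIsoProd M N).symm.toLinearEquiv

variable {ω : S}

instance (X : MatFac S ω) : Module.Finite S X.P₁ := X.finite₁
instance (X : MatFac S ω) : Module.Finite S X.P₀ := X.finite₀
instance (X : MatFac S ω) : Module.Projective S X.P₁ := X.projective₁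
instance (X : MatFac S ω) : Module.Projective S X.P₀ := X.projective₀

instance (X : MatFac S ω) : Projective X.P₁ :=
  (IsProjective.iff_projective (R := S) X.P₁).1 inferInstance
instance (X : MatFac S ω) : Projective X.P₀ :=
  (IsProjective.iff_projective (R := S) X.P₀).1 inferInstance

lemma ρ₁_ρ₀_assoc (X : MatFac S ω) {A : ModuleCat.{u} S} (h : X.P₁ ⟶ A) :
    X.ρ₁ ≫ X.ρ₀ ≫ h = (ω • 𝟙 X.P₁) ≫ h := by
  rw [← Category.assoc, X.ρ₁_ρ₀]

lemma ρ₀_ρ₁_assoc (X : MatFac S ω) {A : ModuleCat.{u} S} (h : X.P₀ ⟶ A) :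
    X.ρ₀ ≫ X.ρ₁ ≫ h = (ω • 𝟙 X.P₀) ≫ h := by
  rw [← Category.assoc, X.ρ₀_ρ₁]

lemma Hom.comm₁_assoc {X Y : MatFac S ω} (f : X ⟶ Y) {A : ModuleCat.{u} S} (h : Y.P₀ ⟶ A) :
    X.ρ₁ ≫ f.φ₀ ≫ h = f.φ₁ ≫ Y.ρ₁ ≫ h := by
  rw [← Category.assoc, f.comm₁, Category.assoc]

lemma Hom.comm₀_assoc {X Y : MatFac S ω} (f : X ⟶ Y) {A : ModuleCat.{u} S} (h : Y.P₁ ⟶ A) :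
    X.ρ₀ ≫ f.φ₁ ≫ h = f.φ₀ ≫ Y.ρ₀ ≫ h := by
  rw [← Category.assoc, f.comm₀, Category.assoc]

/-! ### Finite biproducts -/

/-- The direct sum of two matrix factorizations. -/
noncomputable def directSum (X Y : MatFac S ω) : MatFac S ω where
  P₁ := X.P₁ ⊞ Y.P₁
  P₀ := X.P₀ ⊞ Y.P₀
  ρ₁ := biprod.map X.ρ₁ Y.ρ₁
  ρ₀ := biprod.map X.ρ₀ Y.ρ₀
  finite₁ := finite_biprod _ _
  projective₁ := projective_biprod _ _
  finite₀ := finite_biprod _ _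
  projective₀ := projective_biprod _ _
  ρ₁_ρ₀ := by apply biprod.hom_ext' <;> simp [ρ₁_ρ₀_assoc]
  ρ₀_ρ₁ := by apply biprod.hom_ext' <;> simp [ρ₀_ρ₁_assoc]

/-- The direct sum as a binary bicone. -/
noncomputable def directSumBicone (X Y : MatFac S ω) : BinaryBicone X Y where
  pt := directSum X Y
  fst := ⟨biprod.fst, biprod.fst, by simp [directSum], by simp [directSum]⟩
  snd := ⟨biprod.snd, biprod.snd, by simp [directSum], by simp [directSum]⟩
  inl := ⟨biprod.inl, biprod.inl, by simp [directSum], by simp [directSum]⟩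
  inr := ⟨biprod.inr, biprod.inr, by simp [directSum], by simp [directSum]⟩
  inl_fst := by ext1 <;> exact biprod.inl_fst
  inl_snd := by ext1 <;> exact biprod.inl_snd
  inr_fst := by ext1 <;> exact biprod.inr_fst
  inr_snd := by ext1 <;> exact biprod.inr_snd

instance : HasBinaryBiproducts (MatFac S ω) where
  has_binary_biproduct X Y := hasBinaryBiproduct_of_total (directSumBicone X Y)
    (by ext1 <;> exact biprod.total)

instance : HasZeroObject (MatFac S ω) where
  zero := by
    let Z : MatFac S ω :=
      { P₁ := ModuleCat.of S PUnit
        P₀ := ModuleCat.of S PUnit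
        ρ₁ := 0
        ρ₀ := 0
        finite₁ := inferInstance
        projective₁ := inferInstance
        finite₀ := inferInstance
        projective₀ := inferInstance
        ρ₁_ρ₀ := (ModuleCat.isZero_of_subsingleton _).eq_of_src _ _
        ρ₀_ρ₁ := (ModuleCat.isZero_of_subsingleton _).eq_of_src _ _ }
    refine ⟨Z, (IsZero.iff_id_eq_zero _).2 ?_⟩
    ext1 <;> exact (ModuleCat.isZero_of_subsingleton _).eq_of_src _ _

instance : HasFiniteBiproducts (MatFac S ω) :=
  have : HasFiniteProducts (MatFac S ω) := hasFiniteProducts_of_has_binary_and_terminal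
  HasFiniteBiproducts.of_hasFiniteProducts

/-! ### Kernels and cokernels -/

/-- The cokernel of a degreewise split monomorphism. -/
noncomputable def coker {X Y : MatFac S ω} (i : X ⟶ Y) [IsSplitMono i.φ₁] [IsSplitMono i.φ₀] :
    MatFac S ω where
  P₁ := cokernel i.φ₁
  P₀ := cokernel i.φ₀
  ρ₁ := cokernel.map _ _ X.ρ₁ Y.ρ₁ i.comm₁.symm
  ρ₀ := cokernel.map _ _ X.ρ₀ Y.ρ₀ i.comm₀.symm
  finite₁ := finite_of_splitEpi (cokernel.π i.φ₁)
  projective₁ := projective_of_splitEpi (cokernel.π i.φ₁)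
  finite₀ := finite_of_splitEpi (cokernel.π i.φ₀)
  projective₀ := projective_of_splitEpi (cokernel.π i.φ₀)
  ρ₁_ρ₀ := by rw [← cancel_epi (cokernel.π i.φ₁)]; simp [ρ₁_ρ₀_assoc]
  ρ₀_ρ₁ := by rw [← cancel_epi (cokernel.π i.φ₀)]; simp [ρ₀_ρ₁_assoc]

/-- The projection onto the cokernel of a degreewise split monomorphism. -/
noncomputable def cokerπ {X Y : MatFac S ω} (i : X ⟶ Y) [IsSplitMono i.φ₁] [IsSplitMono i.φ₀] :
    Y ⟶ coker i :=
  ⟨cokernel.π i.φ₁, cokernel.π i.φ₀, by simp [coker], by simp [coker]⟩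

lemma comp_cokerπ {X Y : MatFac S ω} (i : X ⟶ Y) [IsSplitMono i.φ₁] [IsSplitMono i.φ₀] :
    i ≫ cokerπ i = 0 := by
  ext1 <;> exact cokernel.condition _

lemma conflation_cokerπ {X Y : MatFac S ω} (i : X ⟶ Y) [IsSplitMono i.φ₁] [IsSplitMono i.φ₀] :
    conflation S ω (ShortComplex.mk i (cokerπ i) (comp_cokerπ i)) :=
  ⟨{ exact := ShortComplex.exact_of_g_is_cokernel _ (cokernelIsCokernel i.φ₁)
     mono_f := inferInstanceAs (Mono i.φ₁)
     epi_g := inferInstanceAs (Epi (cokernel.π i.φ₁)) },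
   { exact := ShortComplex.exact_of_g_is_cokernel _ (cokernelIsCokernel i.φ₀)
     mono_f := inferInstanceAs (Mono i.φ₀)
     epi_g := inferInstanceAs (Epi (cokernel.π i.φ₀)) }⟩

/-- The kernel of a degreewise split epimorphism. -/
noncomputable def ker {X Y : MatFac S ω} (p : X ⟶ Y) [IsSplitEpi p.φ₁] [IsSplitEpi p.φ₀] :
    MatFac S ω where
  P₁ := kernel p.φ₁
  P₀ := kernel p.φ₀
  ρ₁ := kernel.map _ _ X.ρ₁ Y.ρ₁ p.comm₁.symm
  ρ₀ := kernel.map _ _ X.ρ₀ Y.ρ₀ p.comm₀.symm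
  finite₁ := finite_of_splitEpi (retraction (kernel.ι p.φ₁))
  projective₁ := projective_of_splitEpi (retraction (kernel.ι p.φ₁))
  finite₀ := finite_of_splitEpi (retraction (kernel.ι p.φ₀))
  projective₀ := projective_of_splitEpi (retraction (kernel.ι p.φ₀))
  ρ₁_ρ₀ := by rw [← cancel_mono (kernel.ι p.φ₁)]; simp [ρ₁_ρ₀]
  ρ₀_ρ₁ := by rw [← cancel_mono (kernel.ι p.φ₀)]; simp [ρ₀_ρ₁]

/-- The inclusion of the kernel of a degreewise split epimorphism. -/
noncomputable def kerι {X Y : MatFac S ω} (p : X ⟶ Y) [IsSplitEpi p.φ₁] [IsSplitEpi p.φ₀] :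
    ker p ⟶ X :=
  ⟨kernel.ι p.φ₁, kernel.ι p.φ₀, by simp [ker], by simp [ker]⟩

lemma kerι_comp {X Y : MatFac S ω} (p : X ⟶ Y) [IsSplitEpi p.φ₁] [IsSplitEpi p.φ₀] :
    kerι p ≫ p = 0 := by
  ext1 <;> exact kernel.condition _

lemma conflation_kerι {X Y : MatFac S ω} (p : X ⟶ Y) [IsSplitEpi p.φ₁] [IsSplitEpi p.φ₀] :
    conflation S ω (ShortComplex.mk (kerι p) p (kerι_comp p)) :=
  ⟨{ exact := ShortComplex.exact_of_f_is_kernel _ (kernelIsKernel p.φ₁)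
     mono_f := inferInstanceAs (Mono (kernel.ι p.φ₁))
     epi_g := inferInstanceAs (Epi p.φ₁) },
   { exact := ShortComplex.exact_of_f_is_kernel _ (kernelIsKernel p.φ₀)
     mono_f := inferInstanceAs (Mono (kernel.ι p.φ₀))
     epi_g := inferInstanceAs (Epi p.φ₀) }⟩

/-- In each degree, a conflation is split. -/
lemma splitting_of_conflation {T : ShortComplex (MatFac S ω)} (hT : conflation S ω T) :
    Nonempty (T.map (eval₁ S ω)).Splitting ∧ Nonempty (T.map (eval₀ S ω)).Splitting := by
  have : Projective (T.map (eval₁ S ω)).X₃ := inferInstanceAs (Projective T.X₃.P₁)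
  have : Projective (T.map (eval₀ S ω)).X₃ := inferInstanceAs (Projective T.X₃.P₀)
  exact ⟨⟨hT.1.splittingOfProjective⟩, ⟨hT.2.splittingOfProjective⟩⟩

/-- The cokernel of an inflation is projective in each degree, which forces splitting; conversely a
split cokernel is again finitely generated projective. The retractions need not commute with `ρ₁`
and `ρ₀`. -/
lemma isInflation_iff {X Y : MatFac S ω} (i : X ⟶ Y) :
    IsInflation (conflation S ω) i ↔ IsSplitMono i.φ₁ ∧ IsSplitMono i.φ₀ := by
  constructor
  · rintro ⟨Z, p, w, h⟩
    obtain ⟨⟨s₁⟩, ⟨s₀⟩⟩ := splitting_of_conflation h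
    exact ⟨⟨⟨s₁.r, s₁.f_r⟩⟩, ⟨⟨s₀.r, s₀.f_r⟩⟩⟩
  · rintro ⟨_, _⟩
    exact ⟨_, _, _, conflation_cokerπ i⟩

lemma isDeflation_iff {X Y : MatFac S ω} (p : X ⟶ Y) :
    IsDeflation (conflation S ω) p ↔ IsSplitEpi p.φ₁ ∧ IsSplitEpi p.φ₀ := by
  constructor
  · rintro ⟨Z, i, w, h⟩
    obtain ⟨⟨s₁⟩, ⟨s₀⟩⟩ := splitting_of_conflation h
    exact ⟨⟨⟨s₁.s, s₁.s_g⟩⟩, ⟨⟨s₀.s, s₀.s_g⟩⟩⟩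
  · rintro ⟨_, _⟩
    exact ⟨_, _, _, conflation_kerι p⟩

/-- Lifts exist in each degree, and they commute with the structure maps because the components of
`T.f` can be cancelled. -/
lemma isKernel_of_conflation {T : ShortComplex (MatFac S ω)} (hT : conflation S ω T) :
    Nonempty (IsLimit (KernelFork.ofι T.f T.zero)) := by
  have h₁ : Mono T.f.φ₁ := hT.1.mono_f
  have := hT.1.mono_f
  have := hT.2.mono_f
  have h₀ : Mono T.f.φ₀ := hT.2.mono_f
  have hf : Mono T.f := ⟨fun g h hgh => by
    ext1
    · exact (cancel_mono T.f.φ₁).1 (congr_arg Hom.φ₁ hgh)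
    · exact (cancel_mono T.f.φ₀).1 (congr_arg Hom.φ₀ hgh)⟩
  refine ⟨KernelFork.IsLimit.ofι' _ _ fun {A} k hk => ?_⟩
  obtain ⟨l₁, hl₁⟩ : { l : A.P₁ ⟶ T.X₁.P₁ // l ≫ T.f.φ₁ = k.φ₁ } :=
    ⟨hT.1.exact.lift (k := k.φ₁) (congr_arg Hom.φ₁ hk), hT.1.exact.lift_f _ _⟩
  obtain ⟨l₀, hl₀⟩ : { l : A.P₀ ⟶ T.X₁.P₀ // l ≫ T.f.φ₀ = k.φ₀ } :=
    ⟨hT.2.exact.lift (k := k.φ₀) (congr_arg Hom.φ₀ hk), hT.2.exact.lift_f _ _⟩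
  refine ⟨⟨l₁, l₀, ?_, ?_⟩, by ext1 <;> assumption⟩
  · rw [← cancel_mono T.f.φ₀, Category.assoc, hl₀, k.comm₁, Category.assoc, T.f.comm₁,
      reassoc_of% hl₁]
  · rw [← cancel_mono T.f.φ₁, Category.assoc, hl₁, k.comm₀, Category.assoc, T.f.comm₀,
      reassoc_of% hl₀]

lemma isCokernel_of_conflation {T : ShortComplex (MatFac S ω)} (hT : conflation S ω T) :
    Nonempty (IsColimit (CokernelCofork.ofπ T.g T.zero)) := by
  have h₁ : Epi T.g.φ₁ := hT.1.epi_g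
  have := hT.1.epi_g
  have := hT.2.epi_g
  have h₀ : Epi T.g.φ₀ := hT.2.epi_g
  have hg : Epi T.g := ⟨fun g h hgh => by
    ext1
    · exact (cancel_epi T.g.φ₁).1 (congr_arg Hom.φ₁ hgh)
    · exact (cancel_epi T.g.φ₀).1 (congr_arg Hom.φ₀ hgh)⟩
  refine ⟨CokernelCofork.IsColimit.ofπ' _ _ fun {A} k hk => ?_⟩
  obtain ⟨l₁, hl₁⟩ : { l : T.X₃.P₁ ⟶ A.P₁ // T.g.φ₁ ≫ l = k.φ₁ } :=
    ⟨hT.1.exact.desc (k := k.φ₁) (congr_arg Hom.φ₁ hk), hT.1.exact.g_desc _ _⟩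
  obtain ⟨l₀, hl₀⟩ : { l : T.X₃.P₀ ⟶ A.P₀ // T.g.φ₀ ≫ l = k.φ₀ } :=
    ⟨hT.2.exact.desc (k := k.φ₀) (congr_arg Hom.φ₀ hk), hT.2.exact.g_desc _ _⟩
  refine ⟨⟨l₁, l₀, ?_, ?_⟩, by ext1 <;> assumption⟩
  · rw [← cancel_epi T.g.φ₁, ← T.g.comm₁_assoc, hl₀, k.comm₁, reassoc_of% hl₁]
  · rw [← cancel_epi T.g.φ₀, ← T.g.comm₀_assoc, hl₁, k.comm₀, reassoc_of% hl₀]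

/-! ### The exact structure -/

/-- The push-out is the cokernel of `(i, -f) : X ⟶ Y ⊞ X'`, which is split in each degree because
`i` is. -/
lemma inflation_pushout {X Y X' : MatFac S ω} (i : X ⟶ Y) (f : X ⟶ X')
    (hi : IsInflation (conflation S ω) i) :
    ∃ (Y' : MatFac S ω) (f' : Y ⟶ Y') (i' : X' ⟶ Y'), IsPushout i f f' i' ∧
      IsInflation (conflation S ω) i' := by
  obtain ⟨_, _⟩ := (isInflation_iff i).1 hi
  let j := biprod.lift i (-f)
  have hj : j ≫ biprod.fst = i := biprod.lift_fst _ _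
  have hj' : j ≫ biprod.snd = -f := biprod.lift_snd _ _
  have : IsSplitMono j.φ₁ := ⟨⟨(biprod.fst : Y ⊞ X' ⟶ Y).φ₁ ≫ retraction i.φ₁, by
    rw [← Category.assoc, ← comp_φ₁, hj, IsSplitMono.id]⟩⟩
  have : IsSplitMono j.φ₀ := ⟨⟨(biprod.fst : Y ⊞ X' ⟶ Y).φ₀ ≫ retraction i.φ₀, by
    rw [← Category.assoc, ← comp_φ₀, hj, IsSplitMono.id]⟩⟩
  have hT := conflation_cokerπ j
  have hw : i ≫ biprod.inl ≫ cokerπ j = f ≫ biprod.inr ≫ cokerπ j := by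
    rw [← sub_eq_zero, ← comp_cokerπ j, ← Category.assoc, ← Category.assoc f,
      ← Preadditive.sub_comp]
    congr 1
    apply biprod.hom_ext <;> simp [j]
  obtain ⟨hc⟩ := isCokernel_of_conflation hT
  refine ⟨coker j, biprod.inl ≫ cokerπ j, biprod.inr ≫ cokerπ j, ⟨⟨hw⟩, ⟨?_⟩⟩, ?_⟩
  · refine (CommSq.isColimitEquivIsColimitCokernelCofork ⟨hw⟩).symm ?_
    exact hc.ofIsoColimit (Cofork.ext (Iso.refl _) (by
      dsimp
      rw [Category.comp_id]
      apply biprod.hom_ext' <;> simp))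
  · rw [isInflation_iff]
    constructor
    -- With `r` a retraction of `i`, the map `(y, x') ↦ f (r y) + x'` kills every `(i x, -f x)` and
    -- restricts to the identity on `X'`.
    · refine ⟨⟨cokernel.desc j.φ₁ ((biprod.fst : Y ⊞ X' ⟶ Y).φ₁ ≫ retraction i.φ₁ ≫ f.φ₁ +
        (biprod.snd : Y ⊞ X' ⟶ X').φ₁) ?_, ?_⟩⟩
      · rw [Preadditive.comp_add, ← comp_φ₁, ← Category.assoc, ← comp_φ₁, hj, hj',
          IsSplitMono.id_assoc, neg_φ₁, add_neg_cancel]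
      · refine (Category.assoc _ _ _).trans ((_ ≫= cokernel.π_desc _ _ _).trans ?_)
        rw [Preadditive.comp_add, ← Category.assoc, ← comp_φ₁, ← comp_φ₁, biprod.inr_fst,
          biprod.inr_snd, zero_φ₁, zero_comp, zero_add, id_φ₁]
    · refine ⟨⟨cokernel.desc j.φ₀ ((biprod.fst : Y ⊞ X' ⟶ Y).φ₀ ≫ retraction i.φ₀ ≫ f.φ₀ +
        (biprod.snd : Y ⊞ X' ⟶ X').φ₀) ?_, ?_⟩⟩
      · rw [Preadditive.comp_add, ← comp_φ₀, ← Category.assoc, ← comp_φ₀, hj, hj',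
          IsSplitMono.id_assoc, neg_φ₀, add_neg_cancel]
      · refine (Category.assoc _ _ _).trans ((_ ≫= cokernel.π_desc _ _ _).trans ?_)
        rw [Preadditive.comp_add, ← Category.assoc, ← comp_φ₀, ← comp_φ₀, biprod.inr_fst,
          biprod.inr_snd, zero_φ₀, zero_comp, zero_add, id_φ₀]

/-- Dually, the pull-back is the kernel of `(p, -g) : Y ⊞ Z' ⟶ Z`. With `s` a section of `p` in one
degree, `z' ↦ (s (g z'), z')` splits its projection to `Z'`. -/
lemma deflation_pullback {Y Z Z' : MatFac S ω} (p : Y ⟶ Z) (g : Z' ⟶ Z)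
    (hp : IsDeflation (conflation S ω) p) :
    ∃ (Y' : MatFac S ω) (g' : Y' ⟶ Y) (p' : Y' ⟶ Z'), IsPullback g' p' p g ∧
      IsDeflation (conflation S ω) p' := by
  obtain ⟨_, _⟩ := (isDeflation_iff p).1 hp
  let q := biprod.desc p (-g)
  have hq : biprod.inl ≫ q = p := biprod.inl_desc _ _
  have hq' : biprod.inr ≫ q = -g := biprod.inr_desc _ _
  have : IsSplitEpi q.φ₁ := ⟨⟨section_ p.φ₁ ≫ (biprod.inl : Y ⟶ Y ⊞ Z').φ₁, by
    rw [Category.assoc, ← comp_φ₁, hq, IsSplitEpi.id]⟩⟩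
  have : IsSplitEpi q.φ₀ := ⟨⟨section_ p.φ₀ ≫ (biprod.inl : Y ⟶ Y ⊞ Z').φ₀, by
    rw [Category.assoc, ← comp_φ₀, hq, IsSplitEpi.id]⟩⟩
  have hT := conflation_kerι q
  have hw : (kerι q ≫ biprod.fst) ≫ p = (kerι q ≫ biprod.snd) ≫ g := by
    rw [← sub_eq_zero, ← kerι_comp q, Category.assoc, Category.assoc, ← Preadditive.comp_sub]
    congr 1
    apply biprod.hom_ext' <;> simp [q]
  obtain ⟨hc⟩ := isKernel_of_conflation hT
  refine ⟨ker q, kerι q ≫ biprod.fst, kerι q ≫ biprod.snd, ⟨⟨hw⟩, ⟨?_⟩⟩, ?_⟩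
  · refine (CommSq.isLimitEquivIsLimitKernelFork ⟨hw⟩).symm ?_
    exact hc.ofIsoLimit (Fork.ext (Iso.refl _) (by
      dsimp
      rw [Category.id_comp]
      apply biprod.hom_ext <;> simp))
  · rw [isDeflation_iff]
    constructor
    · refine ⟨⟨kernel.lift q.φ₁ (g.φ₁ ≫ section_ p.φ₁ ≫ (biprod.inl : Y ⟶ Y ⊞ Z').φ₁ +
        (biprod.inr : Z' ⟶ Y ⊞ Z').φ₁) ?_, ?_⟩⟩
      · rw [Preadditive.add_comp, ← comp_φ₁, Category.assoc, Category.assoc, ← comp_φ₁, hq, hq',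
          IsSplitEpi.id, Category.comp_id, neg_φ₁, add_neg_cancel]
      · refine (Category.assoc _ _ _).symm.trans ((kernel.lift_ι _ _ _ =≫ _).trans ?_)
        rw [Preadditive.add_comp, Category.assoc, Category.assoc, ← comp_φ₁, ← comp_φ₁,
          biprod.inl_snd, biprod.inr_snd, zero_φ₁, comp_zero, comp_zero, zero_add, id_φ₁]
    · refine ⟨⟨kernel.lift q.φ₀ (g.φ₀ ≫ section_ p.φ₀ ≫ (biprod.inl : Y ⟶ Y ⊞ Z').φ₀ +
        (biprod.inr : Z' ⟶ Y ⊞ Z').φ₀) ?_, ?_⟩⟩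
      · rw [Preadditive.add_comp, ← comp_φ₀, Category.assoc, Category.assoc, ← comp_φ₀, hq, hq',
          IsSplitEpi.id, Category.comp_id, neg_φ₀, add_neg_cancel]
      · refine (Category.assoc _ _ _).symm.trans ((kernel.lift_ι _ _ _ =≫ _).trans ?_)
        rw [Preadditive.add_comp, Category.assoc, Category.assoc, ← comp_φ₀, ← comp_φ₀,
          biprod.inl_snd, biprod.inr_snd, zero_φ₀, comp_zero, comp_zero, zero_add, id_φ₀]

instance isExactCategory : IsExactCategory (conflation S ω) where
  hasFiniteBiproducts := inferInstance
  closedUnderIso := ⟨fun e h =>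
    ⟨ShortComplex.shortExact_of_iso ((eval₁ S ω).mapShortComplex.mapIso e) h.1,
      ShortComplex.shortExact_of_iso ((eval₀ S ω).mapShortComplex.mapIso e) h.2⟩⟩
  isKernel _ := isKernel_of_conflation
  isCokernel _ := isCokernel_of_conflation
  inflation_id X := (isInflation_iff _).2 ⟨inferInstanceAs (IsSplitMono (𝟙 X.P₁)),
    inferInstanceAs (IsSplitMono (𝟙 X.P₀))⟩
  deflation_id X := (isDeflation_iff _).2 ⟨inferInstanceAs (IsSplitEpi (𝟙 X.P₁)),
    inferInstanceAs (IsSplitEpi (𝟙 X.P₀))⟩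
  inflation_comp i j hi hj := by
    rw [isInflation_iff] at hi hj ⊢
    obtain ⟨_, _⟩ := hi
    obtain ⟨_, _⟩ := hj
    exact ⟨inferInstanceAs (IsSplitMono (i.φ₁ ≫ j.φ₁)), inferInstanceAs (IsSplitMono (i.φ₀ ≫ j.φ₀))⟩
  deflation_comp p q hp hq := by
    rw [isDeflation_iff] at hp hq ⊢
    obtain ⟨_, _⟩ := hp
    obtain ⟨_, _⟩ := hq
    exact ⟨inferInstanceAs (IsSplitEpi (p.φ₁ ≫ q.φ₁)), inferInstanceAs (IsSplitEpi (p.φ₀ ≫ q.φ₀))⟩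
  inflation_pushout := inflation_pushout
  deflation_pullback := deflation_pullback

/-! ### Projective and injective objects -/

/-- The contractible matrix factorization with `ρ₁ = 𝟙` and `ρ₀ = ω`. -/
def idSmul (ω : S) (A : ModuleCat.{u} S) [Module.Finite S A] [Module.Projective S A] :
    MatFac S ω where
  P₁ := A
  P₀ := A
  ρ₁ := 𝟙 A
  ρ₀ := ω • 𝟙 A
  finite₁ := inferInstance
  projective₁ := inferInstance
  finite₀ := inferInstance
  projective₀ := inferInstance
  ρ₁_ρ₀ := by simp
  ρ₀_ρ₁ := by simp

/-- The contractible matrix factorization with `ρ₁ = ω` and `ρ₀ = 𝟙`. -/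
def smulId (ω : S) (A : ModuleCat.{u} S) [Module.Finite S A] [Module.Projective S A] :
    MatFac S ω where
  P₁ := A
  P₀ := A
  ρ₁ := ω • 𝟙 A
  ρ₀ := 𝟙 A
  finite₁ := inferInstance
  projective₁ := inferInstance
  finite₀ := inferInstance
  projective₀ := inferInstance
  ρ₁_ρ₀ := by simp
  ρ₀_ρ₁ := by simp

section

variable {A : ModuleCat.{u} S} [Module.Finite S A] [Module.Projective S A] (X : MatFac S ω)

/-- Morphisms out of `idSmul ω A` are given by morphisms out of `A` in degree one. -/
@[simps]
def idSmulDesc (f : A ⟶ X.P₁) : idSmul ω A ⟶ X where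
  φ₁ := f
  φ₀ := f ≫ X.ρ₁
  comm₁ := by simp [idSmul]
  comm₀ := by simp [idSmul, ρ₁_ρ₀]

/-- Morphisms into `idSmul ω A` are given by morphisms into `A` in degree zero. -/
@[simps]
def idSmulLift (f : X.P₀ ⟶ A) : X ⟶ idSmul ω A where
  φ₁ := X.ρ₁ ≫ f
  φ₀ := f
  comm₁ := by simp [idSmul]
  comm₀ := by simp [idSmul, ρ₀_ρ₁_assoc]

/-- Morphisms out of `smulId ω A` are given by morphisms out of `A` in degree zero. -/
@[simps]
def smulIdDesc (f : A ⟶ X.P₀) : smulId ω A ⟶ X where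
  φ₁ := f ≫ X.ρ₀
  φ₀ := f
  comm₁ := by simp [smulId, ρ₀_ρ₁]
  comm₀ := by simp [smulId]

/-- Morphisms into `smulId ω A` are given by morphisms into `A` in degree one. -/
@[simps]
def smulIdLift (f : X.P₁ ⟶ A) : X ⟶ smulId ω A where
  φ₁ := f
  φ₀ := X.ρ₀ ≫ f
  comm₁ := by simp [smulId, ρ₁_ρ₀_assoc]
  comm₀ := by simp [smulId]

variable {X}

/-- This and the next three lemmas give the uniqueness half of four adjunctions: `idSmul ω` is left
adjoint to evaluation in degree one and right adjoint to evaluation in degree zero, and `smulId ω`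
has the degrees interchanged. -/
lemma idSmul_desc_ext {f g : idSmul ω A ⟶ X} (h : f.φ₁ = g.φ₁) : f = g := by
  ext1
  · exact h
  · exact (Category.id_comp _).symm.trans (f.comm₁.trans ((h =≫ _).trans
      (g.comm₁.symm.trans (Category.id_comp _))))

lemma idSmul_lift_ext {f g : X ⟶ idSmul ω A} (h : f.φ₀ = g.φ₀) : f = g := by
  ext1
  · exact (Category.comp_id _).symm.trans (f.comm₁.symm.trans ((_ ≫= h).trans
      (g.comm₁.trans (Category.comp_id _))))
  · exact h

lemma smulId_desc_ext {f g : smulId ω A ⟶ X} (h : f.φ₀ = g.φ₀) : f = g := by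
  ext1
  · exact (Category.id_comp _).symm.trans (f.comm₀.trans ((h =≫ _).trans
      (g.comm₀.symm.trans (Category.id_comp _))))
  · exact h

lemma smulId_lift_ext {f g : X ⟶ smulId ω A} (h : f.φ₁ = g.φ₁) : f = g := by
  ext1
  · exact h
  · exact (Category.comp_id _).symm.trans (f.comm₀.symm.trans ((_ ≫= h).trans
      (g.comm₀.trans (Category.comp_id _))))

end

variable (A : ModuleCat.{u} S) [Module.Finite S A] [Module.Projective S A]

/-- By adjunction a lift is needed in a single degree only, where deflations split. The three lemmas
after this one use the same argument. -/
lemma isProj_idSmul : IsProj (conflation S ω) (idSmul ω A) := fun Y Z p hp f => by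
  obtain ⟨_, _⟩ := (isDeflation_iff p).1 hp
  refine ⟨idSmulDesc Y (f.φ₁ ≫ section_ p.φ₁), idSmul_desc_ext ?_⟩
  exact (Category.assoc _ _ _).trans ((_ ≫= IsSplitEpi.id _).trans (Category.comp_id _))

lemma isProj_smulId : IsProj (conflation S ω) (smulId ω A) := fun Y Z p hp f => by
  obtain ⟨_, _⟩ := (isDeflation_iff p).1 hp
  refine ⟨smulIdDesc Y (f.φ₀ ≫ section_ p.φ₀), smulId_desc_ext ?_⟩
  exact (Category.assoc _ _ _).trans ((_ ≫= IsSplitEpi.id _).trans (Category.comp_id _))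

lemma isInj_idSmul : IsInj (conflation S ω) (idSmul ω A) := fun X Y i hi f => by
  obtain ⟨_, _⟩ := (isInflation_iff i).1 hi
  exact ⟨idSmulLift Y (retraction i.φ₀ ≫ f.φ₀), idSmul_lift_ext (IsSplitMono.id_assoc _ _)⟩

lemma isInj_smulId : IsInj (conflation S ω) (smulId ω A) := fun X Y i hi f => by
  obtain ⟨_, _⟩ := (isInflation_iff i).1 hi
  exact ⟨smulIdLift Y (retraction i.φ₁ ≫ f.φ₁), smulId_lift_ext (IsSplitMono.id_assoc _ _)⟩

/-- The canonical deflation of a projective-injective matrix factorization onto `X`. -/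
noncomputable def cover (X : MatFac S ω) : idSmul ω X.P₁ ⊞ smulId ω X.P₀ ⟶ X :=
  biprod.desc (idSmulDesc X (𝟙 _)) (smulIdDesc X (𝟙 _))

/-- The summand `idSmul ω X.P₁` maps identically onto `X` in degree one, and `smulId ω X.P₀` does so
in degree zero. -/
lemma isDeflation_cover (X : MatFac S ω) : IsDeflation (conflation S ω) (cover X) := by
  refine (isDeflation_iff _).2
    ⟨⟨⟨(biprod.inl : idSmul ω X.P₁ ⟶ idSmul ω X.P₁ ⊞ smulId ω X.P₀).φ₁, ?_⟩⟩,
      ⟨⟨(biprod.inr : smulId ω X.P₀ ⟶ idSmul ω X.P₁ ⊞ smulId ω X.P₀).φ₀, ?_⟩⟩⟩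
  · exact congr_arg Hom.φ₁ (biprod.inl_desc (idSmulDesc X (𝟙 _)) (smulIdDesc X (𝟙 _)))
  · exact congr_arg Hom.φ₀ (biprod.inr_desc (idSmulDesc X (𝟙 _)) (smulIdDesc X (𝟙 _)))

/-- The canonical inflation of `X` into a projective-injective matrix factorization. -/
noncomputable def envelope (X : MatFac S ω) : X ⟶ idSmul ω X.P₀ ⊞ smulId ω X.P₁ :=
  biprod.lift (idSmulLift X (𝟙 _)) (smulIdLift X (𝟙 _))

lemma isInflation_envelope (X : MatFac S ω) : IsInflation (conflation S ω) (envelope X) := by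
  refine (isInflation_iff _).2
    ⟨⟨⟨(biprod.snd : idSmul ω X.P₀ ⊞ smulId ω X.P₁ ⟶ smulId ω X.P₁).φ₁, ?_⟩⟩,
      ⟨⟨(biprod.fst : idSmul ω X.P₀ ⊞ smulId ω X.P₁ ⟶ idSmul ω X.P₀).φ₀, ?_⟩⟩⟩
  · exact congr_arg Hom.φ₁ (biprod.lift_snd (idSmulLift X (𝟙 _)) (smulIdLift X (𝟙 _)))
  · exact congr_arg Hom.φ₀ (biprod.lift_fst (idSmulLift X (𝟙 _)) (smulIdLift X (𝟙 _)))

instance isFrobenius : IsFrobenius (conflation S ω) where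
  enoughProj X := ⟨_, cover X, (isProj_idSmul _).biprod (isProj_smulId _), isDeflation_cover X⟩
  enoughInj X := ⟨_, envelope X, (isInj_idSmul _).biprod (isInj_smulId _), isInflation_envelope X⟩
  proj_iff_inj X := by
    constructor
    -- A projective object is a retract of its cover, whose summands are also injective; dually for
    -- the envelope.
    · intro h
      obtain ⟨s, hs⟩ := h _ (isDeflation_cover X) (𝟙 X)
      exact ((isInj_idSmul _).biprod (isInj_smulId _)).of_retract s _ hs
    · intro h
      obtain ⟨r, hr⟩ := h _ (isInflation_envelope X) (𝟙 X)
      exact ((isProj_idSmul _).biprod (isProj_smulId _)).of_retract _ r hr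

end MatFac

/-! ### The equivalence between matrix factorizations and monomorphisms. -/

namespace MatFac

open QuillenExact

variable {S : Type u} [CommRing S] {ω : S}

/-- Every `ω • x` lies in the range of `f`, so `g x` can be its unique preimage. The second identity
follows from the first by cancelling `f`. -/
lemma exists_matFac {P Q : ModuleCat.{u} S} (f : P ⟶ Q) [Module.Projective S Q] [Mono f]
    (h : ∀ x : Q ⧸ LinearMap.range f.hom, ω • x = 0) :
    ∃ g : Q ⟶ P, g ≫ f = ω • 𝟙 Q ∧ f ≫ g = ω • 𝟙 P := by
  have hf : Function.Injective f.hom := (ModuleCat.mono_iff_injective f).1 inferInstance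
  have hr (x : Q) : ω • x ∈ LinearMap.range f.hom := by
    rw [← Submodule.Quotient.mk_eq_zero, Submodule.Quotient.mk_smul]
    exact h _
  let e := LinearEquiv.ofInjective f.hom hf
  let g : Q ⟶ P := ModuleCat.ofHom
    (e.symm.toLinearMap ∘ₗ (LinearMap.lsmul S Q ω).codRestrict _ hr)
  have hg : g ≫ f = ω • 𝟙 Q := by
    ext x
    exact congr_arg Subtype.val (e.apply_symm_apply ⟨ω • x, hr x⟩)
  refine ⟨g, hg, ?_⟩
  rw [← cancel_mono f, Category.assoc, hg, Linear.comp_smul, Linear.smul_comp, Category.comp_id,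
    Category.id_comp]

/-- Following `ρ₁` by `ρ₀` gives multiplication by `ω`, which is injective on the flat module `P₁`.
This is where regularity of `ω` enters. -/
lemma mono_ρ₁ (hω : ω ∈ nonZeroDivisors S) (X : MatFac S ω) : Mono X.ρ₁ := by
  rw [ModuleCat.mono_iff_injective]
  intro x y h
  have h' := congr_arg X.ρ₀.hom h
  rw [← LinearMap.comp_apply, ← LinearMap.comp_apply, ← ModuleCat.hom_comp, X.ρ₁_ρ₀] at h'
  exact Module.Flat.isSMulRegular_of_nonZeroDivisors hω h'

variable (hω : ω ∈ nonZeroDivisors S)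

/-- The functor which forgets the second map of a matrix factorization. -/
def toMonProj : MatFac S ω ⥤ MonProj S ω where
  obj X := ⟨Arrow.mk X.ρ₁, ⟨X.finite₁, X.projective₁⟩, ⟨X.finite₀, X.projective₀⟩,
    mono_ρ₁ hω X, by
      intro x
      obtain ⟨y, rfl⟩ := Submodule.mkQ_surjective _ x
      rw [← map_smul]
      refine (Submodule.Quotient.mk_eq_zero _).2 ⟨X.ρ₀.hom y, ?_⟩
      exact congr_arg (fun k : X.P₀ ⟶ X.P₀ => k.hom y) X.ρ₀_ρ₁⟩
  map f := ObjectProperty.homMk (Arrow.homMk f.φ₁ f.φ₀ f.comm₁.symm)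

instance : (toMonProj hω).Additive where

instance : (toMonProj hω).Faithful where
  map_injective {X Y f g} h := by
    ext1
    · exact congr_arg (MonProj.eval₁ S ω).map h
    · exact congr_arg (MonProj.eval₀ S ω).map h

/-- Compatibility with `ρ₀` is automatic: after composing with the monomorphism `Y.ρ₁`, both sides
become `ω` times the degree-zero component. -/
instance : (toMonProj hω).Full where
  map_surjective {X Y} f := by
    have h := f.hom.w
    have := mono_ρ₁ hω Y
    refine ⟨⟨f.hom.left, f.hom.right, h.symm, ?_⟩, rfl⟩
    rw [← cancel_mono Y.ρ₁]
    refine (Category.assoc _ _ _).trans ((_ ≫= h).trans ?_)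
    refine (Category.assoc _ _ _).symm.trans ((X.ρ₀_ρ₁ =≫ _).trans ?_)
    refine Eq.trans ?_ (Category.assoc _ _ _).symm
    refine Eq.trans ?_ (_ ≫= Y.ρ₀_ρ₁).symm
    exact (Linear.smul_comp _ _ _ _ _ _).trans ((congr_arg (ω • ·)
      ((Category.id_comp _).trans (Category.comp_id _).symm)).trans
        (Linear.comp_smul _ _ _ _ _ _).symm)

instance : (toMonProj hω).EssSurj where
  mem_essImage X := by
    obtain ⟨⟨_, _⟩, ⟨_, _⟩, _, h⟩ := X.property
    obtain ⟨g, h₁, h₂⟩ := exists_matFac X.obj.hom h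
    let Y : MatFac S ω := ⟨X.obj.left, X.obj.right, X.obj.hom, g, inferInstance, inferInstance,
      inferInstance, inferInstance, h₂, h₁⟩
    exact ⟨Y, ⟨Iso.refl _⟩⟩

instance : (toMonProj hω).IsEquivalence where

instance : (MonProj.conflation S ω).IsClosedUnderIsomorphisms :=
  ⟨fun e h =>
    ⟨ShortComplex.shortExact_of_iso ((MonProj.eval₁ S ω).mapShortComplex.mapIso e) h.1,
      ShortComplex.shortExact_of_iso ((MonProj.eval₀ S ω).mapShortComplex.mapIso e) h.2⟩⟩

instance : (toMonProj hω).inv.Additive :=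
  have : (toMonProj hω).asEquivalence.functor.Additive :=
    inferInstanceAs (toMonProj hω).Additive
  inferInstanceAs (toMonProj hω).asEquivalence.inverse.Additive

/-- A sequence in `MatFac` is a conflation exactly when its image under `toMonProj` is, by
definition, since the underlying modules are the same. The counit then identifies the image of the
inverse with `T`. -/
lemma conflation_inv_iff (T : ShortComplex (MonProj S ω)) :
    MonProj.conflation S ω T ↔ conflation S ω (T.map (toMonProj hω).inv) := by
  change _ ↔ MonProj.conflation S ω ((T.map (toMonProj hω).inv).map (toMonProj hω))
  exact (MonProj.conflation S ω).prop_iff_of_iso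
    (ShortComplex.mapNatIso T (toMonProj hω).asEquivalence.counitIso).symm

end MatFac

theorem corollary3p9 (S : Type u) [CommRing S] [IsNoetherianRing S] [IsLocalRing S]
    (ω : S) (hω : ω ∈ IsLocalRing.maximalIdeal S) (hreg : ω ∈ nonZeroDivisors S) :
    ∃ (_ : QuillenExact.IsFrobenius (MonProj.conflation S ω))
      (_ : QuillenExact.IsFrobenius (MatFac.conflation S ω))
      (F : QuillenExact.TriangleFunctor (MonProj.conflation S ω) (MatFac.conflation S ω)),
      F.functor.IsEquivalence := by
  have hE := MatFac.conflation_inv_iff hreg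
  -- The equivalence used is the inverse of `toMonProj`, so the Frobenius structure of `MonProj` is
  -- pulled back from that of `MatFac`.
  have := QuillenExact.IsFrobenius.of_equivalence _ hE
  exact ⟨this, inferInstance, QuillenExact.TriangleFunctor.ofEquivalence _ hE,
    QuillenExact.stableFunctor_isEquivalence _ hE⟩
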